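/- Let $V:\mathbb R^3\to\mathbb R$ be measurable, not almost everywhere zero, with $|\cdot|V\in L^\infty(\mathbb R^3)$. For $T,\mu>0$ let $K_{T,\mu}$ be the operator of multiplication in momentum space by $$K_{T,\mu}(p)=\frac{|p^2-\mu|}{\tanh\left(\frac{|p^2-\mu|}{2T}\right)}$$ (with the value $2T$ where $p^2=\mu$), and define the BCS critical temperature $$T_c(\mu)=\inf\{T>0 \mid K_{T,\mu}(p)+V(x)\ge 0\},$$ where $K_{T,\mu}(p)+V(x)\ge0$ is understood in the sense of quadratic forms on the form domain $H^1(\mathbb R^3)$ of $K_{T,\mu}$. Put $$C_2=\sqrt{\frac{\pi}{2\,\||\cdot|V\|_{L^\infty}}}.$$ Then for every $\mu_0>0$ there is a constant $C_1>0$, depending only on $V$ and $\mu_0$, such that for all $\mu\ge\mu_0$ the set in the definition of $T_c(\mu)$ is non-empty and $$T_c(\mu)\le C_1\,\mu\,\exp\left(-C_2\,\mu^{1/4}\right).$$ -/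

import Mathlib

open MeasureTheory
open scoped FourierTransform ENNReal

noncomputable section

/-- Position and momentum space `ℝ³` with the Euclidean norm. -/
abbrev R3 : Type := EuclideanSpace ℝ (Fin 3)

/-- The symbol `K_{T,μ}(p) = |p² - μ| / tanh (|p² - μ| / (2T))`; on the Fermi sphere `p² = μ`
it takes its limiting value `2T`. -/
def bcsSymbol (T μ : ℝ) (p : R3) : ℝ :=
  if ‖p‖ ^ 2 = μ then 2 * T
  else |‖p‖ ^ 2 - μ| / Real.tanh (|‖p‖ ^ 2 - μ| / (2 * T))

/-- The density in `ξ` of the kinetic form `⟨ψ, K_{T,μ}(-i∇) ψ⟩`. Mathlib's unitary Fourier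
transform has the kernel `exp (-2πi x·ξ)`, so the momentum is `p = 2πξ`. -/
def kineticDensity (T μ : ℝ) (ψ : Lp ℂ 2 (volume : Measure R3)) (ξ : R3) : ℝ :=
  bcsSymbol T μ ((2 * Real.pi) • ξ) * ‖(𝓕 ψ : Lp ℂ 2 (volume : Measure R3)) ξ‖ ^ 2

/-- The density in `x` of the potential form `⟨ψ, V ψ⟩`. -/
def potentialDensity (V : R3 → ℝ) (ψ : Lp ℂ 2 (volume : Measure R3)) (x : R3) : ℝ :=
  V x * ‖ψ x‖ ^ 2

/-- `K_{T,μ}(p) + V(x) ≥ 0` in the sense of quadratic forms: on the form domain of `K_{T,μ}`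
(which for `T > 0` is `H¹(ℝ³)`), the form of `V` is well defined and
`⟨ψ, (K_{T,μ} + V) ψ⟩ ≥ 0`. -/
def BCSNonneg (T μ : ℝ) (V : R3 → ℝ) : Prop :=
  ∀ ψ : Lp ℂ 2 (volume : Measure R3), Integrable (kineticDensity T μ ψ) →
    Integrable (potentialDensity V ψ) ∧
      0 ≤ (∫ ξ, kineticDensity T μ ψ ξ) + ∫ x, potentialDensity V ψ x

/-- The set of temperatures `T > 0` with `K_{T,μ}(p) + V(x) ≥ 0`. -/
def normalTemperatures (μ : ℝ) (V : R3 → ℝ) : Set ℝ :=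
  {T : ℝ | 0 < T ∧ BCSNonneg T μ V}

/-- The BCS critical temperature `T_c = inf {T > 0 | K_{T,μ}(p) + V(x) ≥ 0}`. -/
def criticalTemperature (μ : ℝ) (V : R3 → ℝ) : ℝ :=
  sInf (normalTemperatures μ V)

/-- The norm `‖ |·| V ‖_{L^∞(ℝ³)}`. -/
def weightedSupNorm (V : R3 → ℝ) : ℝ :=
  lpNorm (fun x : R3 => ‖x‖ * V x) ∞ volume

end

/-! Write W for `weightedSupNorm V`. Almost everywhere |V| ≤ W/|x|, so it is enough that W/|x| ≤ K
as quadratic forms, and since T_c is an infimum, one admissible T of the claimed size suffices.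

On the Fourier side 1/|x| has the kernel 1/(π|ξ-η|²). A weighted Schur test gives 1/|x| ≤ cκ for
every positive measurable weight κ such that ∫ κ(η)⁻¹/(π|ξ-η|²) dη ≤ c for almost every ξ
(`lintegral_inv_norm_mul_sq_le`). The weight used is κ = max(2T, |p²-μ|) ≤ K with T = τμ.
Integrating out the angles leaves a one-dimensional integral in which a logarithmic singularity at r
= |ξ| can meet the singularity 1/|r-k| at the Fermi radius k, cut off at relative distance τ. This
produces a squared logarithm, and c = 2(log(1/τ)+11)²/(π√μ) works
(`lintegral_inv_symbolMinorant_le`).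

Then c = 1/W exactly when log(1/τ) + 11 = C₂μ^(1/4), that is T = e¹¹ μ exp(-C₂μ^(1/4)). The estimate
needs τ ≤ 1, hence large μ. On the remaining bounded range of μ the constant C₁ is taken so large
that K dominates the weight belonging to one fixed larger chemical potential. -/

/-! ### The L² inverse Fourier transform as an integral on L¹ ∩ L². -/

theorem fourierInv_eq_fourierIntegral {E : Type*} [NormedAddCommGroup E]
    [InnerProductSpace ℝ E] [FiniteDimensional ℝ E] [MeasurableSpace E] [BorelSpace E]
    (φ : E → ℂ) :
    𝓕⁻ φ = VectorFourier.fourierIntegral Real.fourierChar volume (-innerₗ E) φ := by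
  ext x
  rw [Real.fourierInv_eq]
  simp [VectorFourier.fourierIntegral]

theorem continuous_fourierInv {E : Type*} [NormedAddCommGroup E] [InnerProductSpace ℝ E]
    [FiniteDimensional ℝ E] [MeasurableSpace E] [BorelSpace E] {φ : E → ℂ}
    (h : Integrable φ) : Continuous (𝓕⁻ φ) := by
  rw [← Real.Lp.fourierTransformInv_toLp (memLp_one_iff_integrable.2 h)]
  exact (Real.Lp.fourierTransformInv _).continuous

/-- Both sides define the same distribution: paired with a test function g, each transform can be
moved onto g, for the L² one through its compatibility with tempered distributions, for the integral
one by Fubini. -/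
theorem fourierInv_toLp_ae_eq {E : Type*} [NormedAddCommGroup E] [InnerProductSpace ℝ E]
    [FiniteDimensional ℝ E] [MeasurableSpace E] [BorelSpace E] {φ : E → ℂ}
    (h₁ : Integrable φ) (h₂ : MemLp φ 2) :
    ((𝓕⁻ (h₂.toLp φ) : Lp ℂ 2 (volume : Measure E)) : E → ℂ) =ᵐ[volume] 𝓕⁻ φ := by
  apply ae_eq_of_integral_contDiff_smul_eq
  · exact (Lp.memLp _).locallyIntegrable (by norm_num)
  · exact (continuous_fourierInv h₁).locallyIntegrable
  intro g g_smooth g_cpt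
  have hg₁ : HasCompactSupport (Complex.ofRealCLM ∘ g) := g_cpt.comp_left rfl
  have hg₂ : ContDiff ℝ (⊤ : ℕ∞) (Complex.ofRealCLM ∘ g) := Complex.ofRealCLM.contDiff.comp g_smooth
  set G := hg₁.toSchwartzMap hg₂ with hG
  have hGg : ∀ x, G x = (g x : ℂ) := fun x ↦ by simp [hG]
  have key := congrArg (fun u ↦ u G)
    (Lp.fourierInv_toTemperedDistribution_eq (h₂.toLp φ))
  simp only [TemperedDistribution.fourierInv_apply, Lp.toTemperedDistribution_apply] at key
  have e1 : ∫ x, g x • ((𝓕⁻ (h₂.toLp φ) : Lp ℂ 2 (volume : Measure E)) : E → ℂ) x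
      = ∫ x, (𝓕⁻ G) x • φ x := by
    have e0 : ∫ x, (𝓕⁻ G) x • φ x = ∫ x, (𝓕⁻ G) x • (h₂.toLp φ) x :=
      integral_congr_ae (h₂.coeFn_toLp.mono fun x hx ↦ by simp only [hx])
    rw [e0, key]
    simp [hGg]
  rw [e1]
  have e2 := VectorFourier.integral_fourierIntegral_smul_eq_flip (L := -innerₗ E)
    (μ := (volume : Measure E)) (ν := (volume : Measure E)) (f := G) (g := φ)
    Real.continuous_fourierChar (by simp; fun_prop) G.integrable h₁
  have e3 : ∀ x, (𝓕⁻ G) x = VectorFourier.fourierIntegral Real.fourierChar volume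
      (-innerₗ E) G x := fun x ↦ by
    rw [SchwartzMap.fourierInv_coe, fourierInv_eq_fourierIntegral]
  simp_rw [e3, e2, hGg]
  congr 1; ext x
  rw [Real.fourierInv_eq]
  simp [VectorFourier.fourierIntegral, real_inner_comm]

/-! ### The form of 1/|x| in Fourier space, by superposing Gaussians. -/

theorem lintegral_gaussian_superposition {r : ℝ} (hr : 0 < r) :
    ∫⁻ b in Set.Ioi (0 : ℝ), ENNReal.ofReal (b ^ (-(1 / 2) : ℝ) * Real.exp (-b * r ^ 2))
      = ENNReal.ofReal (Real.sqrt Real.pi / r) := by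
  have h := Real.integral_rpow_mul_exp_neg_mul_Ioi (a := 1 / 2) (r := r ^ 2) (by norm_num)
    (by positivity)
  rw [← ofReal_integral_eq_lintegral_ofReal]
  · congr 1
    calc _ = ∫ t in Set.Ioi (0 : ℝ), t ^ ((1 / 2 : ℝ) - 1) * Real.exp (-(r ^ 2 * t)) := by
          refine setIntegral_congr_fun measurableSet_Ioi fun t _ ↦ ?_
          norm_num
          left; ring
      _ = _ := by
          rw [h, Real.Gamma_one_half_eq, one_div, Real.inv_rpow (by positivity),
            ← Real.sqrt_eq_rpow, Real.sqrt_sq hr.le]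
          field_simp
  · have := integrableOn_rpow_mul_exp_neg_mul_rpow (s := -(1/2)) (p := 1) (b := r ^ 2)
      (by norm_num) one_pos (by positivity)
    refine this.congr_fun (fun t _ ↦ ?_) measurableSet_Ioi
    simp only [Real.rpow_one]
    congr 2; ring
  · refine (ae_restrict_mem measurableSet_Ioi).mono fun t (ht : 0 < t) ↦ ?_
    positivity

/-- The superposition that builds 1/|x| from Gaussians, applied to their Fourier transforms; the
substitution y = 1/b turns the integrand into a plain exponential. -/
theorem lintegral_gaussian_kernel_superposition {ρ : ℝ} (hρ : 0 < ρ) :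
    ∫⁻ b in Set.Ioi (0 : ℝ), ENNReal.ofReal (b ^ (-(1 / 2) : ℝ) *
        ((Real.pi / b) ^ (3 / 2 : ℝ) * Real.exp (-Real.pi ^ 2 * ρ ^ 2 / b)))
      = ENNReal.ofReal (Real.sqrt Real.pi * (Real.pi * ρ ^ 2)⁻¹) := by
  set c := Real.pi ^ 2 * ρ ^ 2 with hc
  have hc0 : 0 < c := by positivity
  have hexp : ∫ y in Set.Ioi (0 : ℝ), Real.exp (-c * y) = 1 / c := by
    rw [integral_exp_mul_Ioi (by linarith)]; simp
  have hint : IntegrableOn (fun y ↦ Real.exp (-c * y)) (Set.Ioi (0 : ℝ)) :=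
    integrableOn_exp_mul_Ioi (by linarith) 0
  have h1 := integral_comp_rpow_Ioi (fun y ↦ Real.exp (-c * y)) (p := -1) (by norm_num)
  have h2 := (integrableOn_Ioi_comp_rpow_iff (fun y ↦ Real.exp (-c * y)) (p := -1)
    (by norm_num)).2 hint
  have heq : ∀ b ∈ Set.Ioi (0 : ℝ), b ^ (-(1 / 2) : ℝ) *
        ((Real.pi / b) ^ (3 / 2 : ℝ) * Real.exp (-Real.pi ^ 2 * ρ ^ 2 / b)) =
        Real.pi ^ (3 / 2 : ℝ) *
          ((|(-1 : ℝ)| * b ^ ((-1 : ℝ) - 1)) • Real.exp (-c * b ^ (-1 : ℝ))) := by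
    intro b (hb : 0 < b)
    have e1 : (Real.pi / b) ^ (3 / 2 : ℝ) = Real.pi ^ (3 / 2 : ℝ) * b ^ (-(3 / 2) : ℝ) := by
      rw [Real.div_rpow Real.pi_pos.le hb.le, Real.rpow_neg hb.le, div_eq_mul_inv]
    have e2 : b ^ ((-1 : ℝ) - 1) = b ^ (-(1 / 2) : ℝ) * b ^ (-(3 / 2) : ℝ) := by
      rw [← Real.rpow_add hb]; norm_num
    have e3 : -c * b ^ (-1 : ℝ) = -Real.pi ^ 2 * ρ ^ 2 / b := by
      rw [Real.rpow_neg_one, hc]; field_simp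
    rw [e1, e2, e3]
    simp
    ring
  rw [setLIntegral_congr_fun measurableSet_Ioi fun b hb ↦ by rw [heq b hb],
    ← ofReal_integral_eq_lintegral_ofReal]
  · rw [integral_const_mul, h1, hexp]
    congr 1
    have : Real.pi ^ (3 / 2 : ℝ) = Real.pi * Real.sqrt Real.pi := by
      rw [Real.sqrt_eq_rpow, ← Real.rpow_one_add' Real.pi_pos.le (by norm_num)]; norm_num
    rw [this, hc]
    field_simp
  · exact h2.const_mul _
  · refine (ae_restrict_mem measurableSet_Ioi).mono fun t (ht : 0 < t) ↦ ?_
    simp only [smul_eq_mul]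
    positivity

theorem integrable_gaussian_mul_fourierInv {φ : R3 → ℂ} (hφ : Integrable φ) {b : ℝ} (hb : 0 < b) :
    Integrable fun x : R3 ↦ Complex.exp (-b * ‖x‖ ^ 2) * 𝓕⁻ φ x := by
  have hg : Integrable fun x : R3 ↦ Complex.exp (-(b : ℂ) * ‖x‖ ^ 2) := by
    simpa using GaussianFourier.integrable_cexp_neg_mul_sq_norm_add (V := R3) (b := b)
      (by simpa using hb) 0 0
  refine hg.mul_bdd (c := ∫ x, ‖φ x‖) (continuous_fourierInv hφ).aestronglyMeasurable
    (Filter.Eventually.of_forall fun x ↦ ?_)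
  rw [fourierInv_eq_fourierIntegral]
  exact VectorFourier.norm_fourierIntegral_le_integral_norm _ _ _ _ _

/-- Fubini moves the first transform off φ, then the second one onto a modulated Gaussian, whose
transform is a translated Gaussian. -/
theorem integral_gaussian_mul_normSq_fourierInv {φ : R3 → ℂ} (hφ : Integrable φ) {b : ℝ}
    (hb : 0 < b) :
    ∫ x, (starRingEnd ℂ) (𝓕⁻ φ x) * (Complex.exp (-b * ‖x‖ ^ 2) * 𝓕⁻ φ x) =
      ∫ ξ, (starRingEnd ℂ) (φ ξ) * ∫ η, ((Real.pi / b : ℂ) ^ (3 / 2 : ℂ) *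
        Complex.exp (-Real.pi ^ 2 * ‖ξ - η‖ ^ 2 / b)) * φ η := by
  have h1 := VectorFourier.integral_sesq_fourierIntegral_eq_neg_flip (L := -innerₗ R3)
    (μ := (volume : Measure R3)) (ν := (volume : Measure R3))
    (f := φ) (g := fun x : R3 ↦ Complex.exp (-b * ‖x‖ ^ 2) * 𝓕⁻ φ x) (innerSL ℂ)
    Real.continuous_fourierChar (by simp; fun_prop) hφ (integrable_gaussian_mul_fourierInv hφ hb)
  rw [← fourierInv_eq_fourierIntegral] at h1
  simp only [innerSL_apply_apply, RCLike.inner_apply'] at h1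
  rw [h1]
  congr 1; ext ξ; congr 1
  have hg : Integrable fun x : R3 ↦ Complex.exp (-(b : ℂ) * ‖x‖ ^ 2 +
      2 * Real.pi * Complex.I * inner ℝ (-ξ) x) :=
    GaussianFourier.integrable_cexp_neg_mul_sq_norm_add (V := R3) (b := b)
      (by simpa using hb) (2 * Real.pi * Complex.I) (-ξ)
  have h2 := VectorFourier.integral_fourierIntegral_smul_eq_flip (L := -innerₗ R3)
    (μ := (volume : Measure R3)) (ν := (volume : Measure R3)) 
    Real.continuous_fourierChar (by simp; fun_prop) hg hφ
  have hflip : (-innerₗ R3).flip = -innerₗ R3 := by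
    ext x y; simp [real_inner_comm]
  rw [hflip, ← fourierInv_eq_fourierIntegral, ← fourierInv_eq_fourierIntegral] at h2
  calc _ = ∫ x, Complex.exp (-(b : ℂ) * ‖x‖ ^ 2 +
      2 * Real.pi * Complex.I * inner ℝ (-ξ) x) • 𝓕⁻ φ x := by
        simp only [VectorFourier.fourierIntegral, hflip]
        congr 1; ext x
        simp [Circle.smul_def, Real.fourierChar_apply, Complex.exp_add, real_inner_comm]
        ring_nf
    _ = _ := by
        rw [← h2]
        congr 1; ext η
        rw [Real.fourierInv_eq_fourier_neg,
          fourier_gaussian_innerProductSpace' (V := R3) (b := b) (by simpa using hb)]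
        have : ‖-ξ - -η‖ = ‖ξ - η‖ := by rw [← norm_neg]; congr 1; abel
        rw [this]
        simp

theorem lintegral_gaussian_mul_fourierInv_le {φ : R3 → ℂ} (hφ : Integrable φ) {b : ℝ}
    (hb : 0 < b) :
    ∫⁻ x : R3, ENNReal.ofReal (Real.exp (-b * ‖x‖ ^ 2)) * ‖𝓕⁻ φ x‖ₑ ^ 2 ≤
      ∫⁻ ξ, ∫⁻ η, ENNReal.ofReal ((Real.pi / b) ^ (3 / 2 : ℝ) *
        Real.exp (-Real.pi ^ 2 * ‖ξ - η‖ ^ 2 / b)) * (‖φ ξ‖ₑ * ‖φ η‖ₑ) := by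
  set F : R3 → ℂ := fun x ↦ (starRingEnd ℂ) (𝓕⁻ φ x) * (Complex.exp (-b * ‖x‖ ^ 2) * 𝓕⁻ φ x)
  have hF : ∀ x, F x = ((Real.exp (-b * ‖x‖ ^ 2) * ‖𝓕⁻ φ x‖ ^ 2 : ℝ) : ℂ) := fun x ↦ by
    simp only [F]
    rw [mul_left_comm, Complex.conj_mul']
    push_cast; rfl
  have hFi : Integrable F := by
    refine (integrable_gaussian_mul_fourierInv hφ hb).bdd_mul (c := ∫ x, ‖φ x‖)
      (Complex.continuous_conj.comp (continuous_fourierInv hφ)).aestronglyMeasurable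
      (Filter.Eventually.of_forall fun x ↦ ?_)
    rw [fourierInv_eq_fourierIntegral, RCLike.norm_conj]
    exact VectorFourier.norm_fourierIntegral_le_integral_norm _ _ _ _ _
  have e1 : ∫⁻ x : R3, ENNReal.ofReal (Real.exp (-b * ‖x‖ ^ 2)) * ‖𝓕⁻ φ x‖ₑ ^ 2 = ‖∫ x, F x‖ₑ := by
    have hG : Integrable fun x : R3 ↦ Real.exp (-b * ‖x‖ ^ 2) * ‖𝓕⁻ φ x‖ ^ 2 := by
      have := hFi.re
      refine this.congr (Filter.Eventually.of_forall fun x ↦ ?_)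
      simp only [hF]; exact Complex.ofReal_re _
    simp_rw [hF]
    rw [integral_complex_ofReal]
    have h0 : 0 ≤ ∫ x : R3, Real.exp (-b * ‖x‖ ^ 2) * ‖𝓕⁻ φ x‖ ^ 2 :=
      integral_nonneg fun x ↦ by positivity
    rw [← ofReal_norm, Complex.norm_real, Real.norm_of_nonneg h0,
      ofReal_integral_eq_lintegral_ofReal hG (Filter.Eventually.of_forall fun x ↦ by positivity)]
    congr 1; ext x
    rw [ENNReal.ofReal_mul (by positivity), ENNReal.ofReal_pow (norm_nonneg _), ofReal_norm]
  rw [e1, integral_gaussian_mul_normSq_fourierInv hφ hb]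
  refine (enorm_integral_le_lintegral_enorm _).trans (lintegral_mono fun ξ ↦ ?_)
  rw [enorm_mul]
  refine (mul_le_mul_right (enorm_integral_le_lintegral_enorm _) _).trans ?_
  rw [← lintegral_const_mul']
  · refine lintegral_mono fun η ↦ le_of_eq ?_
    rw [enorm_mul, ← ofReal_norm (_ * Complex.exp _), norm_mul, Complex.norm_exp,
      ← ofReal_norm ((starRingEnd ℂ) (φ ξ)), RCLike.norm_conj, ofReal_norm]
    have : ‖((Real.pi / b : ℂ) ^ (3 / 2 : ℂ))‖ = (Real.pi / b) ^ (3 / 2 : ℝ) := by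
      rw [← Complex.ofReal_div, Complex.norm_cpow_eq_rpow_re_of_pos (by positivity)]
      norm_num
    rw [this]
    have : (-(Real.pi : ℂ) ^ 2 * ‖ξ - η‖ ^ 2 / b).re = -Real.pi ^ 2 * ‖ξ - η‖ ^ 2 / b := by
      rw [show (-(Real.pi : ℂ) ^ 2 * ‖ξ - η‖ ^ 2 / b) =
        ((-Real.pi ^ 2 * ‖ξ - η‖ ^ 2 / b : ℝ) : ℂ) by push_cast; rfl, Complex.ofReal_re]
    rw [this]
    ring
  · simp

/-- The Gaussian bounds are integrated against b^(-1/2) db. An inequality with absolute values is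
enough, because the Schur test only sees |φ|, and it keeps every integrand nonnegative so that
Tonelli applies. -/
theorem lintegral_inv_norm_mul_fourierInv_le {φ : R3 → ℂ} (hφ : Integrable φ) :
    ∫⁻ x : R3, ENNReal.ofReal ‖x‖⁻¹ * ‖𝓕⁻ φ x‖ₑ ^ 2 ≤
      ∫⁻ ξ, ∫⁻ η, ENNReal.ofReal (Real.pi * ‖ξ - η‖ ^ 2)⁻¹ * (‖φ ξ‖ₑ * ‖φ η‖ₑ) := by
  have hψ := (continuous_fourierInv hφ).measurable
  wlog hm : Measurable φ generalizing φ
  · have hmk := hφ.1.ae_eq_mk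
    have h := this (φ := hφ.1.mk φ) (hφ.congr hmk) (by
      exact (continuous_fourierInv (hφ.congr hmk)).measurable) hφ.1.stronglyMeasurable_mk.measurable
    rw [← funext fun x ↦ Real.fourierInv_congr_ae hmk x] at h
    refine h.trans (le_of_eq ?_)
    refine lintegral_congr_ae (hmk.mono fun ξ hξ ↦ ?_)
    refine lintegral_congr_ae (hmk.mono fun η hη ↦ ?_)
    simp only [hξ, hη]
  -- √π is the common normalisation of the two superposition formulas.
  set s := ENNReal.ofReal (Real.sqrt Real.pi)
  have hs0 : s ≠ 0 := by simp [s, Real.pi_pos]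
  have hst : s ≠ ⊤ := ENNReal.ofReal_ne_top
  rw [← ENNReal.mul_le_mul_iff_right hs0 hst, ← lintegral_const_mul' _ _ hst,
    ← lintegral_const_mul' _ _ hst]
  simp_rw [← lintegral_const_mul' _ _ hst, ← mul_assoc s]
  have hne : ∀ᵐ x : R3, x ≠ 0 := by simp [ae_iff]
  have hne2 : ∀ ξ : R3, ∀ᵐ η : R3, ξ - η ≠ 0 := fun ξ ↦ by simp [ae_iff, sub_eq_zero]
  calc
    _ = ∫⁻ x : R3, ∫⁻ b in Set.Ioi (0 : ℝ),
          ENNReal.ofReal (b ^ (-(1 / 2) : ℝ)) *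
            (ENNReal.ofReal (Real.exp (-b * ‖x‖ ^ 2)) * ‖𝓕⁻ φ x‖ₑ ^ 2) := by
        refine lintegral_congr_ae (hne.mono fun x hx ↦ ?_)
        have hx' : 0 < ‖x‖ := norm_pos_iff.2 hx
        simp only [s]
        rw [← ENNReal.ofReal_mul (by positivity), ← div_eq_mul_inv,
          ← lintegral_gaussian_superposition hx', ← lintegral_mul_const' _ _ (by simp)]
        refine setLIntegral_congr_fun measurableSet_Ioi fun b (hb : 0 < b) ↦ ?_
        rw [ENNReal.ofReal_mul (by positivity), mul_assoc]
    _ = ∫⁻ b in Set.Ioi (0 : ℝ), ∫⁻ x : R3,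
          ENNReal.ofReal (b ^ (-(1 / 2) : ℝ)) *
            (ENNReal.ofReal (Real.exp (-b * ‖x‖ ^ 2)) * ‖𝓕⁻ φ x‖ₑ ^ 2) :=
        lintegral_lintegral_swap (by fun_prop)
    _ ≤ ∫⁻ b in Set.Ioi (0 : ℝ), ∫⁻ ξ, ∫⁻ η, ENNReal.ofReal (b ^ (-(1 / 2) : ℝ)) *
          (ENNReal.ofReal ((Real.pi / b) ^ (3 / 2 : ℝ) *
            Real.exp (-Real.pi ^ 2 * ‖ξ - η‖ ^ 2 / b)) * (‖φ ξ‖ₑ * ‖φ η‖ₑ)) := by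
        refine setLIntegral_mono' measurableSet_Ioi fun b hb ↦ ?_
        simp_rw [lintegral_const_mul' _ _ ENNReal.ofReal_ne_top]
        exact mul_le_mul_right (lintegral_gaussian_mul_fourierInv_le hφ hb) _
    _ = ∫⁻ ξ, ∫⁻ η, ∫⁻ b in Set.Ioi (0 : ℝ), ENNReal.ofReal (b ^ (-(1 / 2) : ℝ)) *
          (ENNReal.ofReal ((Real.pi / b) ^ (3 / 2 : ℝ) *
            Real.exp (-Real.pi ^ 2 * ‖ξ - η‖ ^ 2 / b)) * (‖φ ξ‖ₑ * ‖φ η‖ₑ)) := by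
        rw [lintegral_lintegral_swap]
        · refine lintegral_congr fun ξ ↦ ?_
          rw [lintegral_lintegral_swap]
          exact Measurable.aemeasurable (by fun_prop)
        · exact (Measurable.lintegral_prod_right' (f := fun q : (ℝ × R3) × R3 ↦
            ENNReal.ofReal (q.1.1 ^ (-(1 / 2) : ℝ)) *
            (ENNReal.ofReal ((Real.pi / q.1.1) ^ (3 / 2 : ℝ) *
            Real.exp (-Real.pi ^ 2 * ‖q.1.2 - q.2‖ ^ 2 / q.1.1)) *
              (‖φ q.1.2‖ₑ * ‖φ q.2‖ₑ))) (by fun_prop)).aemeasurable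
    _ = _ := by
        refine lintegral_congr fun ξ ↦ lintegral_congr_ae ((hne2 ξ).mono fun η hη ↦ ?_)
        have hx' : 0 < ‖ξ - η‖ := norm_pos_iff.2 hη
        simp only [s]
        rw [← ENNReal.ofReal_mul (by positivity),
          ← lintegral_gaussian_kernel_superposition hx',
          ← lintegral_mul_const' _ _ (by simp [ENNReal.mul_eq_top])]
        refine setLIntegral_congr_fun measurableSet_Ioi fun b (hb : 0 < b) ↦ ?_
        rw [ENNReal.ofReal_mul (p := b ^ _) (by positivity), mul_assoc]

/-! ### The weighted Schur test. -/

theorem two_mul_le_sq_mul_div_add (a b : ℝ≥0∞) {u v : ℝ} (hu : 0 < u) (hv : 0 < v) :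
    2 * (a * b) ≤ a ^ 2 * (ENNReal.ofReal u * ENNReal.ofReal v⁻¹) +
      b ^ 2 * (ENNReal.ofReal v * ENNReal.ofReal u⁻¹) := by
  have h1 : ENNReal.ofReal u * ENNReal.ofReal v⁻¹ ≠ 0 := by simp [hu, hv]
  have h2 : ENNReal.ofReal v * ENNReal.ofReal u⁻¹ ≠ 0 := by simp [hu, hv]
  rcases eq_or_ne a ⊤ with rfl | ha
  · simp [ENNReal.top_mul h1, -mul_eq_zero]
  rcases eq_or_ne b ⊤ with rfl | hb
  · simp [ENNReal.top_mul h2, -mul_eq_zero]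
  lift a to NNReal using ha
  lift b to NNReal using hb
  rw [← ENNReal.ofReal_coe_nnreal, ← ENNReal.ofReal_coe_nnreal, ← ENNReal.ofReal_mul (by positivity),
    ← ENNReal.ofReal_mul (by positivity),  ← ENNReal.ofReal_mul (by positivity),
    ← ENNReal.ofReal_pow (by positivity), ← ENNReal.ofReal_pow (by positivity),
    ← ENNReal.ofReal_mul (by positivity), ← ENNReal.ofReal_mul (by positivity),
    ← ENNReal.ofReal_add (by positivity) (by positivity),
    ← ENNReal.ofReal_ofNat, ← ENNReal.ofReal_mul (by positivity)]
  refine ENNReal.ofReal_le_ofReal ?_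
  have : (a : ℝ) ^ 2 * (u * v⁻¹) + b ^ 2 * (v * u⁻¹) - 2 * (a * b) = (a * u - b * v) ^ 2 / (u * v) := by
    field_simp; ring
  have h3 : 0 ≤ ((a : ℝ) * u - b * v) ^ 2 / (u * v) := by positivity
  linarith

theorem lintegral_lintegral_add_swap {α : Type*} [MeasurableSpace α] {μ : Measure α} [SFinite μ]
    {A : α → α → ℝ≥0∞} (hA : Measurable (Function.uncurry A)) :
    ∫⁻ x, ∫⁻ y, (A x y + A y x) ∂μ ∂μ = 2 * ∫⁻ x, ∫⁻ y, A x y ∂μ ∂μ := by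
  have hswap : ∫⁻ x, ∫⁻ y, A y x ∂μ ∂μ = ∫⁻ x, ∫⁻ y, A x y ∂μ ∂μ :=
    lintegral_lintegral_swap (hA.comp measurable_swap).aemeasurable
  calc _ = ∫⁻ x, (∫⁻ y, A x y ∂μ + ∫⁻ y, A y x ∂μ) ∂μ := by
        refine lintegral_congr fun x ↦ ?_
        exact lintegral_add_left (hA.comp measurable_prodMk_left) _
    _ = _ := by
        rw [lintegral_add_left (by exact hA.lintegral_prod_right'), hswap, two_mul]

/-- Weighted AM-GM with ratio κ(ξ)/κ(η) splits the product |φ(ξ)||φ(η)| into two terms exchanged by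
ξ ↔ η. By symmetry of the kernel they contribute equally, and integrating the first over η leaves
the hypothesis `hS`. -/
theorem lintegral_lintegral_schur_le {φ : R3 → ℂ} (hφ : AEMeasurable φ) {κ : R3 → ℝ}
    (hκ : Measurable κ) (hκ0 : ∀ ξ, 0 < κ ξ) {c : ℝ≥0∞}
    (hS : ∀ᵐ ξ : R3, ∫⁻ η : R3, ENNReal.ofReal (Real.pi * ‖ξ - η‖ ^ 2)⁻¹ *
      ENNReal.ofReal (κ η)⁻¹ ≤ c) :
    ∫⁻ ξ : R3, ∫⁻ η : R3, ENNReal.ofReal (Real.pi * ‖ξ - η‖ ^ 2)⁻¹ * (‖φ ξ‖ₑ * ‖φ η‖ₑ) ≤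
      c * ∫⁻ ξ, ENNReal.ofReal (κ ξ) * ‖φ ξ‖ₑ ^ 2 := by
  wlog hm : Measurable φ generalizing φ
  · have hmk := hφ.ae_eq_mk
    have h := this hφ.measurable_mk.aemeasurable hφ.measurable_mk
    refine (le_of_eq ?_).trans (h.trans (le_of_eq ?_))
    · refine lintegral_congr_ae (hmk.mono fun ξ hξ ↦ ?_)
      refine lintegral_congr_ae (hmk.mono fun η hη ↦ ?_)
      simp only [hξ, hη]
    · congr 1
      refine lintegral_congr_ae (hmk.mono fun ξ hξ ↦ ?_)
      simp only [hξ]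
  set k : R3 → R3 → ℝ≥0∞ := fun ξ η ↦ ENNReal.ofReal (Real.pi * ‖ξ - η‖ ^ 2)⁻¹ with hk
  set A : R3 → R3 → ℝ≥0∞ := fun ξ η ↦ k ξ η * (‖φ ξ‖ₑ ^ 2 *
    (ENNReal.ofReal (κ ξ) * ENNReal.ofReal (κ η)⁻¹)) with hA
  have hAm : Measurable (Function.uncurry A) := by
    simp only [hA, hk, Function.uncurry_def]; fun_prop
  have hAint : ∫⁻ ξ, ∫⁻ η, A ξ η ≤ c * ∫⁻ ξ, ENNReal.ofReal (κ ξ) * ‖φ ξ‖ₑ ^ 2 := by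
    rw [← lintegral_const_mul _ (by fun_prop)]
    refine lintegral_mono_ae (hS.mono fun ξ hξ ↦ ?_)
    calc ∫⁻ η, A ξ η = ∫⁻ η, (ENNReal.ofReal (κ ξ) * ‖φ ξ‖ₑ ^ 2) *
          (k ξ η * ENNReal.ofReal (κ η)⁻¹) := by
            congr 1; ext η; simp only [hA]; ring
      _ = (ENNReal.ofReal (κ ξ) * ‖φ ξ‖ₑ ^ 2) * ∫⁻ η, (k ξ η * ENNReal.ofReal (κ η)⁻¹) := by
            rw [lintegral_const_mul' _ _ (by simp [ENNReal.mul_eq_top])]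
      _ ≤ _ := by rw [mul_comm c]; gcongr
  rw [← ENNReal.mul_le_mul_iff_right (a := 2) (by simp) (by simp),
    ← lintegral_const_mul' _ _ (by simp)]
  calc _ ≤ ∫⁻ ξ, ∫⁻ η, (A ξ η + A η ξ) := by
        refine lintegral_mono fun ξ ↦ ?_
        rw [← lintegral_const_mul' _ _ (by simp)]
        refine lintegral_mono fun η ↦ ?_
        simp only [hA]
        have : k η ξ = k ξ η := by simp only [hk, norm_sub_rev]
        rw [this, ← mul_add, mul_left_comm]
        gcongr
        exact two_mul_le_sq_mul_div_add _ _ (hκ0 ξ) (hκ0 η)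
    _ = 2 * ∫⁻ ξ, ∫⁻ η, A ξ η := lintegral_lintegral_add_swap hAm
    _ ≤ _ := mul_le_mul_right hAint _

/-- The bound for integrable φ extends to L² by truncating φ to balls: the truncations are
integrable, their inverse transforms converge in L², hence almost everywhere along a subsequence,
and Fatou's lemma applies. -/
theorem lintegral_inv_norm_mul_sq_le {κ : R3 → ℝ}
    (hκ : Measurable κ) (hκ0 : ∀ ξ, 0 < κ ξ) {c : ℝ≥0∞}
    (hS : ∀ᵐ ξ : R3, ∫⁻ η : R3, ENNReal.ofReal (Real.pi * ‖ξ - η‖ ^ 2)⁻¹ *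
      ENNReal.ofReal (κ η)⁻¹ ≤ c) (ψ : Lp ℂ 2 (volume : Measure R3)) :
    ∫⁻ x : R3, ENNReal.ofReal ‖x‖⁻¹ * ‖ψ x‖ₑ ^ 2 ≤
      c * ∫⁻ ξ, ENNReal.ofReal (κ ξ) * ‖(𝓕 ψ : Lp ℂ 2 (volume : Measure R3)) ξ‖ₑ ^ 2 := by
  set φ : Lp ℂ 2 (volume : Measure R3) := 𝓕 ψ with hφ
  have hψ : ψ = 𝓕⁻ φ := (FourierTransform.fourierInv_fourier_eq ψ).symm
  set φn : ℕ → R3 → ℂ := fun n ↦ (Metric.ball (0 : R3) n).indicator φ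
  have hmem : ∀ n, MemLp (φn n) 2 := fun n ↦ (Lp.memLp φ).indicator measurableSet_ball
  have hint : ∀ n, Integrable (φn n) := fun n ↦ by
    rw [integrable_indicator_iff measurableSet_ball]
    have : IsFiniteMeasure ((volume : Measure R3).restrict (Metric.ball 0 n)) :=
      ⟨by simpa using measure_ball_lt_top (μ := (volume : Measure R3)) (x := 0) (r := (n : ℝ))⟩
    exact ((Lp.memLp φ).restrict _).integrable (by norm_num)
  have hle : ∀ n x, ‖φn n x‖ₑ ≤ ‖φ x‖ₑ := fun n x ↦ enorm_indicator_le_enorm_self _ _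
  have hsq : ∫⁻ x, ‖φ x‖ₑ ^ 2 ≠ ⊤ := by
    have := (Lp.memLp φ).2
    have h2 := eLpNorm_nnreal_pow_eq_lintegral (f := φ) (μ := (volume : Measure R3)) (p := 2)
      (by norm_num)
    norm_num at h2
    rw [← h2]
    exact ENNReal.pow_ne_top this.ne
  have hconv : Filter.Tendsto (fun n ↦ (hmem n).toLp (φn n)) Filter.atTop (nhds φ) := by
    rw [Lp.tendsto_Lp_iff_tendsto_eLpNorm']
    have h0 : Filter.Tendsto (fun n ↦ ∫⁻ x, ‖φn n x - φ x‖ₑ ^ 2) Filter.atTop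
        (nhds (∫⁻ _ : R3, 0)) := by
      refine tendsto_lintegral_of_dominated_convergence' (fun x ↦ 4 * ‖φ x‖ₑ ^ 2) (fun n ↦ ?_)
        (fun n ↦ Filter.Eventually.of_forall fun x ↦ ?_) ?_
        (Filter.Eventually.of_forall fun x ↦ ?_)
      · exact ((hmem n).1.sub (Lp.memLp φ).1).enorm.pow_const 2
      · calc ‖φn n x - φ x‖ₑ ^ 2 ≤ (‖φn n x‖ₑ + ‖φ x‖ₑ) ^ 2 := by gcongr; exact enorm_sub_le
          _ ≤ (‖φ x‖ₑ + ‖φ x‖ₑ) ^ 2 := by gcongr; exact hle n x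
          _ = _ := by ring
      · rw [lintegral_const_mul' _ _ (by simp)]
        exact ENNReal.mul_ne_top (by simp) hsq
      · refine tendsto_const_nhds.congr' ?_
        filter_upwards [Filter.eventually_gt_atTop ⌈‖x‖⌉₊] with n hn
        have : x ∈ Metric.ball (0 : R3) n := by
          simpa using (Nat.le_ceil ‖x‖).trans_lt (by exact_mod_cast hn)
        simp [φn, this]
    have h1 : ∀ n, eLpNorm (((hmem n).toLp (φn n) : R3 → ℂ) - (φ : R3 → ℂ)) 2 volume =
        (∫⁻ x, ‖φn n x - φ x‖ₑ ^ 2) ^ (1 / 2 : ℝ) := fun n ↦ by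
      rw [eLpNorm_congr_ae ((hmem n).coeFn_toLp.sub (ae_eq_refl _)),
        eLpNorm_eq_lintegral_rpow_enorm_toReal (by norm_num) (by norm_num)]
      simp
    simp_rw [h1]
    simpa using h0.ennrpow_const (1 / 2 : ℝ)
  have hconv' : Filter.Tendsto (fun n ↦ (𝓕⁻ ((hmem n).toLp (φn n)) : Lp ℂ 2 (volume : Measure R3)))
      Filter.atTop (nhds ψ) := by
    rw [hψ]
    exact ((Lp.fourierTransformₗᵢ R3 ℂ).symm.continuous.tendsto φ).comp hconv
  obtain ⟨ns, -, hns⟩ := (tendstoInMeasure_of_tendsto_Lp hconv').exists_seq_tendsto_ae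
  have hae : ∀ᵐ x : R3, ∀ n, (𝓕⁻ ((hmem n).toLp (φn n)) : Lp ℂ 2 (volume : Measure R3)) x =
      𝓕⁻ (φn n) x := ae_all_iff.2 fun n ↦ fourierInv_toLp_ae_eq (hint n) (hmem n)
  calc ∫⁻ x : R3, ENNReal.ofReal ‖x‖⁻¹ * ‖ψ x‖ₑ ^ 2
      ≤ ∫⁻ x : R3, Filter.liminf (fun k ↦ ENNReal.ofReal ‖x‖⁻¹ * ‖𝓕⁻ (φn (ns k)) x‖ₑ ^ 2)
          Filter.atTop := by
        refine lintegral_mono_ae ?_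
        filter_upwards [hns, hae] with x hx hx'
        simp only [hx'] at hx
        have : Filter.Tendsto (fun k ↦ ENNReal.ofReal ‖x‖⁻¹ * ‖𝓕⁻ (φn (ns k)) x‖ₑ ^ 2)
            Filter.atTop (nhds (ENNReal.ofReal ‖x‖⁻¹ * ‖ψ x‖ₑ ^ 2)) :=
          ENNReal.Tendsto.const_mul (((ENNReal.continuous_pow 2).tendsto _).comp hx.enorm) (Or.inr (by simp))
        rw [this.liminf_eq]
    _ ≤ Filter.liminf (fun k ↦ ∫⁻ x : R3, ENNReal.ofReal ‖x‖⁻¹ * ‖𝓕⁻ (φn (ns k)) x‖ₑ ^ 2)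
          Filter.atTop := by
        refine lintegral_liminf_le fun k ↦ ?_
        have := (continuous_fourierInv (hint (ns k))).measurable
        fun_prop
    _ ≤ _ := by
        refine Filter.liminf_le_of_frequently_le'
          (Filter.Frequently.of_forall fun k ↦ ?_)
        refine (lintegral_inv_norm_mul_fourierInv_le (hint (ns k))).trans
          ((lintegral_lintegral_schur_le (hint (ns k)).1.aemeasurable hκ hκ0 hS).trans ?_)
        gcongr
        exact hle _ _

/-! ### Reduction of the Schur integral to one radial variable. -/

theorem lintegral_Ioi_zero_eq_lintegral_sq_sub_sq (g : ℝ → ℝ≥0∞) {a : ℝ} (ha : 0 ≤ a) :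
    ∫⁻ t in Set.Ioi (0 : ℝ), g t =
      ∫⁻ r in Set.Ioi a, ENNReal.ofReal (2 * r) * g (r ^ 2 - a ^ 2) := by
  have himg : (fun r : ℝ ↦ r ^ 2 - a ^ 2) '' Set.Ioi a = Set.Ioi 0 := by
    ext t
    simp only [Set.mem_image, Set.mem_Ioi]
    constructor
    · rintro ⟨r, hr, rfl⟩
      nlinarith
    · intro ht
      refine ⟨Real.sqrt (t + a ^ 2), Real.lt_sqrt_of_sq_lt (by linarith), ?_⟩
      rw [Real.sq_sqrt (by positivity)]; ring
  rw [← himg]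
  refine lintegral_image_eq_lintegral_deriv_mul_of_monotoneOn measurableSet_Ioi
    (fun r _ ↦ ?_) (fun r hr s hs hrs ↦ ?_) g
  · simpa using ((hasDerivAt_pow 2 r).sub_const (a ^ 2)).hasDerivWithinAt
  · simp only [Set.mem_Ioi] at hr hs
    nlinarith

theorem lintegral_sq_add_sq {h : ℝ → ℝ≥0∞} (hh : Measurable h) :
    ∫⁻ p : ℝ × ℝ, h (p.1 ^ 2 + p.2 ^ 2) =
      ENNReal.ofReal Real.pi * ∫⁻ t in Set.Ioi (0 : ℝ), h t := by
  rw [← lintegral_comp_polarCoord_symm, lintegral_Ioi_zero_eq_lintegral_sq_sub_sq h le_rfl]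
  have h1 : ∀ p : ℝ × ℝ, (polarCoord.symm p).1 ^ 2 + (polarCoord.symm p).2 ^ 2 = p.1 ^ 2 := by
    intro p
    simp only [polarCoord_symm_apply]
    linear_combination p.1 ^ 2 * Real.cos_sq_add_sin_sq p.2
  simp only [h1, polarCoord_target, smul_eq_mul]
  rw [Measure.volume_eq_prod, ← Measure.prod_restrict,
    lintegral_prod _ (Measurable.aemeasurable (by fun_prop)),
    ← lintegral_const_mul' _ _ ENNReal.ofReal_ne_top]
  refine lintegral_congr fun r ↦ ?_
  simp only [lintegral_const, Measure.restrict_apply_univ, Real.volume_Ioo, sub_neg_eq_add]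
  rw [ENNReal.ofReal_mul (by norm_num), ← two_mul, ENNReal.ofReal_mul (by norm_num)]
  simp only [ne_eq, OfNat.ofNat_ne_zero, not_false_eq_true, zero_pow, sub_zero]
  ring

theorem lintegral_euclideanSpace_three {H : ℝ → ℝ → ℝ≥0∞} (hH : Measurable (Function.uncurry H)) :
    ∫⁻ q : R3, H (q 0) (q 1 ^ 2 + q 2 ^ 2) =
      ∫⁻ z : ℝ, ENNReal.ofReal Real.pi * ∫⁻ t in Set.Ioi (0 : ℝ), H z t := by
  have hp := ((MeasurePreserving.id (volume : Measure ℝ)).prod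
    (volume_preserving_finTwoArrow ℝ)).comp
    ((volume_preserving_piFinSuccAbove (fun _ : Fin 3 ↦ ℝ) 0).comp
      (PiLp.volume_preserving_ofLp (Fin 3)))
  have h2 : Measurable fun p : ℝ × ℝ × ℝ ↦ H p.1 (p.2.1 ^ 2 + p.2.2 ^ 2) :=
    hH.comp (by fun_prop : Measurable fun p : ℝ × ℝ × ℝ ↦ (p.1, p.2.1 ^ 2 + p.2.2 ^ 2))
  have := hp.lintegral_comp h2
  calc _ = _ := this
    _ = ∫⁻ z : ℝ, ∫⁻ p : ℝ × ℝ, H z (p.1 ^ 2 + p.2 ^ 2) := lintegral_prod _ h2.aemeasurable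
    _ = _ := lintegral_congr fun z ↦ lintegral_sq_add_sq (hH.comp measurable_prodMk_left)

theorem lintegral_Ioo_inv_sq_add_sq_sub {r P : ℝ} (hr : 0 < r) (hP : 0 < P) (h : r ≠ P) :
    ∫⁻ z in Set.Ioo (-r) r, ENNReal.ofReal (r ^ 2 + P ^ 2 - 2 * P * z)⁻¹ =
      ENNReal.ofReal (P⁻¹ * Real.log ((r + P) / |r - P|)) := by
  have hpos : ∀ z ∈ Set.Icc (-r) r, 0 < r ^ 2 + P ^ 2 - 2 * P * z := by
    intro z hz
    have : 0 < (r - P) ^ 2 := by have := sub_ne_zero.2 h; positivity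
    nlinarith [hz.2]
  have hc : ContinuousOn (fun z ↦ (r ^ 2 + P ^ 2 - 2 * P * z)⁻¹) (Set.Icc (-r) r) :=
    ContinuousOn.inv₀ (by fun_prop) fun z hz ↦ (hpos z hz).ne'
  have hle : -r ≤ r := by linarith
  have hi : IntervalIntegrable (fun z ↦ (r ^ 2 + P ^ 2 - 2 * P * z)⁻¹) volume (-r) r :=
    ContinuousOn.intervalIntegrable (by rwa [Set.uIcc_of_le hle])
  have hint : ∫ z in (-r)..r, (r ^ 2 + P ^ 2 - 2 * P * z)⁻¹ =
      P⁻¹ * Real.log ((r + P) / |r - P|) := by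
    rw [intervalIntegral.integral_eq_sub_of_hasDerivAt
      (f := fun z ↦ -(2 * P)⁻¹ * Real.log (r ^ 2 + P ^ 2 - 2 * P * z)) (fun z hz ↦ ?_) hi]
    · have e1 : r ^ 2 + P ^ 2 - 2 * P * r = |r - P| ^ 2 := by rw [sq_abs]; ring
      have e2 : r ^ 2 + P ^ 2 - 2 * P * -r = (r + P) ^ 2 := by ring
      have h3 : 0 < |r - P| := abs_pos.2 (sub_ne_zero.2 h)
      rw [e1, e2, Real.log_pow, Real.log_pow, Real.log_div (by positivity) h3.ne']
      push_cast
      field_simp; ring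
    · rw [Set.uIcc_of_le hle] at hz
      have h4 := (((hasDerivAt_id z).const_mul (2 * P)).const_sub (r ^ 2 + P ^ 2)).log
        (hpos z hz).ne'
      convert! h4.const_mul (-(2 * P)⁻¹) using 1
      simp
      field_simp
  rw [← hint, intervalIntegral.integral_of_le hle,
    ofReal_integral_eq_lintegral_ofReal (hi.1)]
  · rw [setLIntegral_congr Ioo_ae_eq_Ioc]
  · exact (ae_restrict_mem measurableSet_Ioc).mono fun z hz ↦
      (inv_pos.2 (hpos z (Set.Ioc_subset_Icc_self hz))).le

/-- After p is moved to the first axis, cylindrical coordinates (z, t) are traded for (z, r) with r²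
= z² + t. The squared distance becomes r² + P² - 2Pz, affine in z, so integrating z over (-r, r)
yields the logarithm. -/
theorem lintegral_radial_mul_inv_sq_dist {f : ℝ → ℝ≥0∞} (hf : Measurable f) {p : R3} (hp : p ≠ 0) :
    ∫⁻ q : R3, ENNReal.ofReal (‖p - q‖ ^ 2)⁻¹ * f ‖q‖ =
      ENNReal.ofReal (2 * Real.pi) * ∫⁻ r in Set.Ioi (0 : ℝ),
        ENNReal.ofReal (r / ‖p‖ * Real.log ((r + ‖p‖) / |r - ‖p‖|)) * f r := by
  set P := ‖p‖ with hP
  have hP0 : 0 < P := norm_pos_iff.2 hp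
  set e : R3 := EuclideanSpace.single 0 P with he
  have hen : ‖p‖ = ‖e‖ := by simp [he, hP]
  -- The reflection in the bisecting hyperplane of p and e exchanges these two vectors of equal
  -- norm.
  set A : R3 ≃ₗᵢ[ℝ] R3 := (Submodule.span ℝ {p - e})ᗮ.reflection
  have hA : A p = e := Submodule.reflection_sub hen
  set H : ℝ → ℝ → ℝ≥0∞ := fun z t ↦ ENNReal.ofReal ((P - z) ^ 2 + t)⁻¹ *
    f (Real.sqrt (z ^ 2 + t)) with hH
  have hHm : Measurable (Function.uncurry H) := by
    simp only [hH, Function.uncurry_def]; fun_prop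
  have hnorm : ∀ q : R3, ‖q‖ ^ 2 = q 0 ^ 2 + (q 1 ^ 2 + q 2 ^ 2) := fun q ↦ by
    rw [EuclideanSpace.norm_sq_eq, Fin.sum_univ_three]; simp [add_assoc]
  have hGH : ∀ q : R3, ENNReal.ofReal (‖e - q‖ ^ 2)⁻¹ * f ‖q‖ = H (q 0) (q 1 ^ 2 + q 2 ^ 2) := by
    intro q
    simp only [hH, hnorm (e - q), ← hnorm q, Real.sqrt_sq (norm_nonneg q)]
    simp [he]
  set K : ℝ → ℝ → ℝ≥0∞ := fun z r ↦ ENNReal.ofReal (2 * r) *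
    (ENNReal.ofReal (r ^ 2 + P ^ 2 - 2 * P * z)⁻¹ * f r) with hK
  have hKm : Measurable (Function.uncurry K) := by
    simp only [hK, Function.uncurry_def]; fun_prop
  calc _ = ∫⁻ q : R3, ENNReal.ofReal (‖e - A q‖ ^ 2)⁻¹ * f ‖A q‖ := by
        refine lintegral_congr fun q ↦ ?_
        rw [← hA, ← map_sub, A.norm_map, A.norm_map]
    _ = ∫⁻ q : R3, ENNReal.ofReal (‖e - q‖ ^ 2)⁻¹ * f ‖q‖ :=
        A.measurePreserving.lintegral_comp
          (f := fun q ↦ ENNReal.ofReal (‖e - q‖ ^ 2)⁻¹ * f ‖q‖) (by fun_prop)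
    _ = ∫⁻ z : ℝ, ENNReal.ofReal Real.pi * ∫⁻ t in Set.Ioi (0 : ℝ), H z t := by
        simp_rw [hGH]
        exact lintegral_euclideanSpace_three hHm
    _ = ENNReal.ofReal Real.pi * ∫⁻ z : ℝ, ∫⁻ r in Set.Ioi |z|, K z r := by
        rw [lintegral_const_mul' _ _ ENNReal.ofReal_ne_top]
        congr 1
        refine lintegral_congr fun z ↦ ?_
        rw [lintegral_Ioi_zero_eq_lintegral_sq_sub_sq _ (abs_nonneg z)]
        refine setLIntegral_congr_fun measurableSet_Ioi fun r (hr : |z| < r) ↦ ?_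
        have hr0 : 0 ≤ r := (abs_nonneg z).trans hr.le
        simp only [hH, hK, sq_abs, add_sub_cancel, Real.sqrt_sq hr0]
        congr 4
        ring
    _ = ENNReal.ofReal Real.pi * ∫⁻ z : ℝ, ∫⁻ r : ℝ,
          {q : ℝ × ℝ | |q.1| < q.2}.indicator (Function.uncurry K) (z, r) := by
        congr 1
        refine lintegral_congr fun z ↦ ?_
        rw [← lintegral_indicator measurableSet_Ioi]
        rfl
    _ = ENNReal.ofReal Real.pi * ∫⁻ r : ℝ, ∫⁻ z : ℝ,
          {q : ℝ × ℝ | |q.1| < q.2}.indicator (Function.uncurry K) (z, r) := by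
        congr 1
        refine lintegral_lintegral_swap (Measurable.aemeasurable ?_)
        exact hKm.indicator (measurableSet_lt (by fun_prop) (by fun_prop))
    _ = ENNReal.ofReal Real.pi * ∫⁻ r in Set.Ioi (0 : ℝ), ∫⁻ z in Set.Ioo (-r) r, K z r := by
        congr 1
        rw [← lintegral_indicator measurableSet_Ioi]
        refine lintegral_congr fun r ↦ ?_
        by_cases hr : 0 < r
        · rw [Set.indicator_of_mem (by exact hr), ← lintegral_indicator measurableSet_Ioo]
          refine lintegral_congr fun z ↦ ?_
          simp only [Set.indicator, Set.mem_ofPred_eq, Set.mem_Ioo, abs_lt, Function.uncurry]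
        · rw [Set.indicator_of_notMem (by exact hr)]
          refine (lintegral_congr fun z ↦ ?_).trans lintegral_zero
          refine Set.indicator_of_notMem (fun h ↦ hr ?_) _
          exact (abs_nonneg z).trans_lt h
    _ = _ := by
        rw [← lintegral_const_mul' _ _ ENNReal.ofReal_ne_top,
          ← lintegral_const_mul' _ _ ENNReal.ofReal_ne_top]
        refine lintegral_congr_ae ?_
        have hne : ∀ᵐ r ∂((volume : Measure ℝ).restrict (Set.Ioi 0)), r ≠ P :=
          ae_restrict_of_ae (by simp [ae_iff])
        filter_upwards [hne, ae_restrict_mem measurableSet_Ioi] with r hr (hr0 : 0 < r)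
        simp only [hK]
        rw [lintegral_const_mul' _ _ ENNReal.ofReal_ne_top, lintegral_mul_const _ (by fun_prop),
          lintegral_Ioo_inv_sq_add_sq_sub hr0 hP0 hr, ← mul_assoc, ← mul_assoc, ← mul_assoc]
        congr 1
        rw [← ENNReal.ofReal_mul (by positivity), ← ENNReal.ofReal_mul (by positivity),
          ← ENNReal.ofReal_mul (by positivity)]
        congr 1
        field_simp

/-! ### Estimate of the radial integral, uniform in P. -/

/-- For r < P the prefactor r/P is at most 1. For r > P its excess (r-P)/P over 1 costs at most 2,
by log(1+x) ≤ x. The length k then separates growth in r from the singularity at P. -/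
theorem mul_log_add_div_abs_sub_le {r P k : ℝ} (hr : 0 < r) (hP : 0 < P) (hk : 0 < k)
    (h : r ≠ P) :
    r / P * Real.log ((r + P) / |r - P|) ≤
      2 + Real.log (1 + 2 * r / k) + Real.log (1 + k / |r - P|) := by
  have hd : 0 < |r - P| := abs_pos.2 (sub_ne_zero.2 h)
  have h2 : Real.log (1 + 2 * r / |r - P|) ≤
      Real.log (1 + 2 * r / k) + Real.log (1 + k / |r - P|) := by
    rw [← Real.log_mul (by positivity) (by positivity)]
    refine Real.log_le_log (by positivity) ?_
    have e : (1 + 2 * r / k) * (1 + k / |r - P|) =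
        1 + 2 * r / |r - P| + (2 * r / k + k / |r - P|) := by field_simp; ring
    have : 0 ≤ 2 * r / k + k / |r - P| := by positivity
    linarith
  suffices r / P * Real.log ((r + P) / |r - P|) ≤ 2 + Real.log (1 + 2 * r / |r - P|) by linarith
  rcases lt_or_gt_of_ne h with hlt | hgt
  · have e : (r + P) / |r - P| = 1 + 2 * r / |r - P| := by
      rw [abs_of_neg (by linarith)]
      have : -(r - P) ≠ 0 := by linarith
      field_simp; ring
    rw [e]
    have h0 : 0 ≤ Real.log (1 + 2 * r / |r - P|) :=
      Real.log_nonneg (by have : 0 ≤ 2 * r / |r - P| := by positivity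
                          linarith)
    have h1 : r / P ≤ 1 := (div_le_one hP).2 hlt.le
    nlinarith
  · have hs : |r - P| = r - P := abs_of_pos (by linarith)
    have hδ : 0 < r - P := by linarith
    rw [hs]
    have e : (r + P) / (r - P) = 1 + 2 * P / (r - P) := by field_simp; ring
    have e' : r / P = 1 + (r - P) / P := by field_simp; ring
    rw [e, e', add_mul, one_mul]
    have h3 : Real.log (1 + 2 * P / (r - P)) ≤ 2 * P / (r - P) := by
      have := Real.log_le_sub_one_of_pos (x := 1 + 2 * P / (r - P)) (by positivity)
      linarith
    have h4 : (r - P) / P * Real.log (1 + 2 * P / (r - P)) ≤ 2 := by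
      calc _ ≤ (r - P) / P * (2 * P / (r - P)) := by gcongr
        _ = 2 := by field_simp
    have h5 : Real.log (1 + 2 * P / (r - P)) ≤ Real.log (1 + 2 * r / (r - P)) := by
      gcongr
    linarith

/-- Majorant of the logarithmic factor in terms of the rescaled distance to the singularity. -/
noncomputable def logProfile (w : ℝ) : ℝ := 4 + Real.log (1 + 1 / w)

/-- Majorant of the inverse symbol in terms of the rescaled distance to the Fermi momentum. -/
noncomputable def symbolProfile (τ w : ℝ) : ℝ := if w ≤ 1 then 1 / max τ w + 2 else 3 * w ^ (-(3 / 2) : ℝ)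

theorem logProfile_antitoneOn : AntitoneOn logProfile (Set.Ioi 0) := by
  intro a (ha : 0 < a) b (hb : 0 < b) hab
  unfold logProfile
  gcongr

theorem logProfile_nonneg {w : ℝ} (hw : 0 < w) : 0 ≤ logProfile w := by
  have : 0 ≤ Real.log (1 + 1 / w) := Real.log_nonneg (by
    have : 0 ≤ 1 / w := by positivity
    linarith)
  unfold logProfile; linarith

theorem symbolProfile_nonneg {τ w : ℝ} (hτ : 0 < τ) (hw : 0 < w) : 0 ≤ symbolProfile τ w := by
  unfold symbolProfile
  split_ifs <;> positivity

theorem symbolProfile_antitoneOn {τ : ℝ} (hτ : 0 < τ) (hτ1 : τ ≤ 1) :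
    AntitoneOn (symbolProfile τ) (Set.Ioi 0) := by
  intro a (ha : 0 < a) b (hb : 0 < b) hab
  unfold symbolProfile
  split_ifs with h1 h2 h2
  · gcongr
  · linarith
  · have e1 : 1 ≤ 1 / max τ a := by
      rw [le_div_iff₀ (by positivity), one_mul]; exact max_le hτ1 h2
    have e2 : b ^ (-(3 / 2) : ℝ) ≤ 1 :=
      Real.rpow_le_one_of_one_le_of_nonpos (by linarith) (by norm_num)
    linarith
  · have := Real.rpow_le_rpow_of_nonpos ha hab (z := -(3 / 2)) (by norm_num)
    linarith

/-- Near w = 0 the logarithm is at most w and only adds a bounded term to 1/max(τ, w). For w > 1 it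
is absorbed by √w, so w⁻² weakens to the still integrable w^(-3/2). -/
theorem one_add_log_div_le_symbolProfile {τ w : ℝ} (hτ : 0 < τ) (hw : 0 < w) :
    (1 + Real.log (1 + w)) / max (2 * τ) (w * max 1 w) ≤ symbolProfile τ w := by
  unfold symbolProfile
  have hl : Real.log (1 + w) ≤ w := by
    have := Real.log_le_sub_one_of_pos (x := 1 + w) (by positivity)
    linarith
  split_ifs with h1
  · rw [max_eq_left h1, mul_one]
    have hm : max τ w ≤ max (2 * τ) w := max_le_max (by linarith) le_rfl
    have hm0 : 0 < max τ w := by positivity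
    have hm1 : 0 < max (2 * τ) w := by positivity
    have : 1 / max (2 * τ) w ≤ 1 / max τ w := by gcongr
    have h3 : w / max (2 * τ) w ≤ 1 := (div_le_one hm1).2 (le_max_right _ _)
    calc _ ≤ (1 + w) / max (2 * τ) w := by gcongr
      _ = 1 / max (2 * τ) w + w / max (2 * τ) w := by ring
      _ ≤ _ := by linarith
  · push Not at h1
    rw [max_eq_right h1.le]
    have hs : 1 < Real.sqrt w := by rw [Real.lt_sqrt]; linarith; norm_num
    have hsq : Real.sqrt w ^ 2 = w := Real.sq_sqrt hw.le
    have h2 : 1 + Real.log (1 + w) ≤ 3 * Real.sqrt w := by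
      have e1 : Real.log (1 + w) ≤ 2 * Real.log (1 + Real.sqrt w) := by
        rw [← Nat.cast_ofNat (n := 2), ← Real.log_pow]
        refine Real.log_le_log (by positivity) ?_
        nlinarith
      have e2 : Real.log (1 + Real.sqrt w) ≤ Real.sqrt w := by
        have := Real.log_le_sub_one_of_pos (x := 1 + Real.sqrt w) (by positivity)
        linarith
      linarith
    have hlog : 0 ≤ Real.log (1 + w) := Real.log_nonneg (by linarith)
    calc _ ≤ (3 * Real.sqrt w) / (w * w) := by
          gcongr
          exact le_max_right _ _
      _ = 3 * w ^ (-(3 / 2) : ℝ) := by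
          rw [Real.sqrt_eq_rpow, mul_div_assoc, ← sq, ← Real.rpow_natCast, ← Real.rpow_sub hw]
          norm_num

/-- Decouples singularities at two different points: the product is at most its value with both
arguments equal to the smaller one. The resulting bound no longer depends on the distance between P
and k. -/
theorem mul_le_add_of_antitoneOn {f g : ℝ → ℝ} (hf : AntitoneOn f (Set.Ioi 0))
    (hg : AntitoneOn g (Set.Ioi 0)) (hf0 : ∀ w, 0 < w → 0 ≤ f w) (hg0 : ∀ w, 0 < w → 0 ≤ g w)
    {v w : ℝ} (hv : 0 < v) (hw : 0 < w) : f v * g w ≤ f w * g w + f v * g v := by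
  rcases le_total w v with h | h
  · have := mul_le_mul_of_nonneg_right (hf hw hv h) (hg0 w hw)
    have := mul_nonneg (hf0 v hv) (hg0 v hv)
    linarith
  · have := mul_le_mul_of_nonneg_left (hg hv hw h) (hf0 v hv)
    have := mul_nonneg (hf0 w hw) (hg0 w hw)
    linarith

theorem lintegral_comp_abs_sub_div (g : ℝ → ℝ≥0∞) (a : ℝ) {k : ℝ} (hk : 0 < k) :
    ∫⁻ r : ℝ, g (|r - a| / k) = 2 * ENNReal.ofReal k * ∫⁻ w in Set.Ioi (0 : ℝ), g w := by
  have key : ∀ s : ℝ, |s| = k → ∫⁻ r in (fun w ↦ a + s * w) '' Set.Ioi 0, g (|r - a| / k) =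
      ENNReal.ofReal k * ∫⁻ w in Set.Ioi (0 : ℝ), g w := by
    intro s hs
    have hs0 : s ≠ 0 := by rw [← abs_pos, hs]; exact hk
    rw [lintegral_image_eq_lintegral_abs_deriv_mul (f' := fun _ ↦ s) measurableSet_Ioi
      (fun w _ ↦ ?_) (fun x _ y _ h ↦ by simpa [hs0] using h),
      ← lintegral_const_mul' _ _ ENNReal.ofReal_ne_top]
    · refine setLIntegral_congr_fun measurableSet_Ioi fun w (hw : 0 < w) ↦ ?_
      simp only [hs, add_sub_cancel_left, abs_mul, abs_of_pos hw]
      congr 2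
      field_simp
    · simpa using (((hasDerivAt_id w).const_mul s).const_add a).hasDerivWithinAt
  have i1 : (fun w ↦ a + k * w) '' Set.Ioi 0 = Set.Ioi a := by
    ext x
    simp only [Set.mem_image, Set.mem_Ioi]
    refine ⟨?_, fun h ↦ ⟨(x - a) / k, div_pos (by linarith) hk, by field_simp; ring⟩⟩
    rintro ⟨w, hw, rfl⟩
    have := mul_pos hk hw
    linarith
  have i2 : (fun w ↦ a + -k * w) '' Set.Ioi 0 = Set.Iio a := by
    ext x
    simp only [Set.mem_image, Set.mem_Ioi, Set.mem_Iio]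
    refine ⟨?_, fun h ↦ ⟨(a - x) / k, div_pos (by linarith) hk, by field_simp; ring⟩⟩
    rintro ⟨w, hw, rfl⟩
    have := mul_pos hk hw
    linarith
  have k1 := key k (abs_of_pos hk)
  have k2 := key (-k) (by rw [abs_neg, abs_of_pos hk])
  rw [i1] at k1
  rw [i2] at k2
  rw [← lintegral_add_compl _ (measurableSet_Ioi (a := a)), k1, Set.compl_Ioi,
    ← setLIntegral_congr Iio_ae_eq_Iic, k2]
  ring

/-- The leading term (log τ⁻¹)²/2 is the integral of (-log w)/w over (τ, 1]. The ranges (0, τ] and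
(1, ∞) contribute only a linear term in log τ⁻¹ and constants. -/
theorem lintegral_profile_le {τ : ℝ} (hτ : 0 < τ) (hτ1 : τ ≤ 1) :
    ∫⁻ w in Set.Ioi (0 : ℝ), ENNReal.ofReal (logProfile w * symbolProfile τ w) ≤
      ENNReal.ofReal (Real.log τ⁻¹ ^ 2 / 2 + 8 * Real.log τ⁻¹ + 60) := by
  set L := Real.log τ⁻¹ with hL
  have hlogτ : Real.log τ = -L := by rw [hL, Real.log_inv, neg_neg]
  have hL0 : 0 ≤ L := Real.log_nonneg (one_le_inv_iff₀.2 ⟨hτ, hτ1⟩)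
  have hfle : ∀ w, 0 < w → w ≤ 1 → logProfile w ≤ 5 - Real.log w := by
    intro w hw hw1
    have e : 1 + 1 / w = (1 + w) / w := by field_simp; ring
    have := Real.log_le_sub_one_of_pos (x := 1 + w) (by positivity)
    rw [logProfile, e, Real.log_div (by positivity) hw.ne']
    linarith
  have hlog0 : ∀ w, 0 < w → w ≤ 1 → 0 ≤ 5 - Real.log w := fun w hw hw1 ↦ by
    have := Real.log_nonpos hw.le hw1
    linarith
  have I1 : ∫⁻ w in Set.Ioc 0 τ, ENNReal.ofReal (logProfile w * symbolProfile τ w) ≤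
      ENNReal.ofReal (3 * (6 + L)) := by
    have hi : IntervalIntegrable (fun w ↦ (5 - Real.log w) * (1 / τ + 2)) volume 0 τ :=
      (intervalIntegrable_const.sub intervalIntegral.intervalIntegrable_log').mul_const _
    calc _ ≤ ∫⁻ w in Set.Ioc 0 τ, ENNReal.ofReal ((5 - Real.log w) * (1 / τ + 2)) := by
          refine setLIntegral_mono' measurableSet_Ioc fun w hw ↦ ENNReal.ofReal_le_ofReal ?_
          have hw1 := hw.2.trans hτ1
          rw [symbolProfile, if_pos hw1, max_eq_left hw.2]
          exact mul_le_mul_of_nonneg_right (hfle w hw.1 hw1) (by positivity)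
      _ = ENNReal.ofReal (∫ w in (0)..τ, (5 - Real.log w) * (1 / τ + 2)) := by
          rw [intervalIntegral.integral_of_le hτ.le, ofReal_integral_eq_lintegral_ofReal hi.1]
          exact (ae_restrict_mem measurableSet_Ioc).mono fun w hw ↦
            mul_nonneg (hlog0 w hw.1 (hw.2.trans hτ1)) (by positivity)
      _ ≤ _ := by
          refine ENNReal.ofReal_le_ofReal ?_
          rw [intervalIntegral.integral_mul_const, intervalIntegral.integral_sub
            intervalIntegrable_const intervalIntegral.intervalIntegrable_log', integral_log,
            intervalIntegral.integral_const, hlogτ]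
          have : ((τ - 0) • (5 : ℝ) - (τ * -L - 0 * Real.log 0 - τ + 0)) * (1 / τ + 2) =
            (6 + L) * (1 + 2 * τ) := by
              simp only [smul_eq_mul]; field_simp; ring
          rw [this]
          nlinarith
  have I2 : ∫⁻ w in Set.Ioc τ 1, ENNReal.ofReal (logProfile w * symbolProfile τ w) ≤
      ENNReal.ofReal (L ^ 2 / 2 + 5 * L + 12) := by
    have hi : IntervalIntegrable (fun w ↦ (5 - Real.log w) * (1 / w + 2)) volume τ 1 := by
      refine ContinuousOn.intervalIntegrable ?_
      rw [Set.uIcc_of_le hτ1]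
      have h0 : ∀ w ∈ Set.Icc τ 1, w ≠ 0 := fun w hw ↦ (hτ.trans_le hw.1).ne'
      exact (continuousOn_const.sub (continuousOn_id.log h0)).mul
        ((continuousOn_const.div continuousOn_id h0).add continuousOn_const)
    calc _ ≤ ∫⁻ w in Set.Ioc τ 1, ENNReal.ofReal ((5 - Real.log w) * (1 / w + 2)) := by
          refine setLIntegral_mono' measurableSet_Ioc fun w hw ↦ ENNReal.ofReal_le_ofReal ?_
          have hw0 := hτ.trans hw.1
          rw [symbolProfile, if_pos hw.2, max_eq_right hw.1.le]
          exact mul_le_mul_of_nonneg_right (hfle w hw0 hw.2) (by positivity)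
      _ = ENNReal.ofReal (∫ w in τ..1, (5 - Real.log w) * (1 / w + 2)) := by
          rw [intervalIntegral.integral_of_le hτ1, ofReal_integral_eq_lintegral_ofReal hi.1]
          refine (ae_restrict_mem measurableSet_Ioc).mono fun w hw ↦ ?_
          have hw0 := hτ.trans hw.1
          exact mul_nonneg (hlog0 w hw0 hw.2) (by positivity)
      _ ≤ _ := by
          refine ENNReal.ofReal_le_ofReal ?_
          rw [intervalIntegral.integral_eq_sub_of_hasDerivAt (f := fun w ↦
            5 * Real.log w - Real.log w ^ 2 / 2 + 12 * w - 2 * (w * Real.log w)) ?_ hi]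
          · simp only [Real.log_one, hlogτ]
            nlinarith [mul_nonneg hτ.le hL0]
          · intro w hw
            rw [Set.uIcc_of_le hτ1] at hw
            have hw0 : w ≠ 0 := (hτ.trans_le hw.1).ne'
            have hl := Real.hasDerivAt_log hw0
            convert! (((hl.const_mul 5).sub ((hl.pow 2).div_const 2)).add
              ((hasDerivAt_id w).const_mul 12)).sub
              (((hasDerivAt_id w).mul hl).const_mul 2) using 1
            simp
            field_simp
            ring
  have I3 : ∫⁻ w in Set.Ioi (1 : ℝ), ENNReal.ofReal (logProfile w * symbolProfile τ w) ≤
      ENNReal.ofReal 30 := by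
    have hi := integrableOn_Ioi_rpow_of_lt (a := -(3 / 2)) (by norm_num) one_pos
    calc _ ≤ ∫⁻ w in Set.Ioi (1 : ℝ), ENNReal.ofReal (15 * w ^ (-(3 / 2) : ℝ)) := by
          refine setLIntegral_mono' measurableSet_Ioi fun w (hw : 1 < w) ↦
            ENNReal.ofReal_le_ofReal ?_
          rw [symbolProfile, if_neg (not_le.2 hw)]
          have : logProfile w ≤ 5 := by
            have h1 : 1 / w ≤ 1 := (div_le_one (by linarith)).2 hw.le
            have := Real.log_le_sub_one_of_pos (x := 1 + 1 / w) (by positivity)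
            rw [logProfile]; linarith
          have h0 : 0 ≤ 3 * w ^ (-(3 / 2) : ℝ) := by positivity
          nlinarith
      _ = ENNReal.ofReal (∫ w in Set.Ioi (1 : ℝ), 15 * w ^ (-(3 / 2) : ℝ)) := by
          rw [ofReal_integral_eq_lintegral_ofReal (hi.const_mul 15)]
          refine (ae_restrict_mem measurableSet_Ioi).mono fun w (hw : 1 < w) ↦ ?_
          have : 0 < w := by linarith
          simp only [Pi.zero_apply]
          positivity
      _ = _ := by
          rw [integral_const_mul, integral_Ioi_rpow_of_lt (by norm_num) one_pos]
          norm_num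
  rw [← Set.Ioc_union_Ioi_eq_Ioi hτ.le, ← Set.Ioc_union_Ioi_eq_Ioi hτ1]
  refine (lintegral_union_le _ _ _).trans ((add_le_add I1 ((lintegral_union_le _ _ _).trans
    (add_le_add I2 I3))).trans ?_)
  rw [← ENNReal.ofReal_add (by positivity) (by norm_num),
    ← ENNReal.ofReal_add (by positivity) (by positivity)]
  refine ENNReal.ofReal_le_ofReal ?_
  linarith

theorem log_kernel_mul_inv_le {k τ P r : ℝ} (hk : 0 < k) (hτ : 0 < τ) (hτ1 : τ ≤ 1)
    (hP : 0 < P) (hr : 0 < r) (hrk : r ≠ k) (hrP : r ≠ P) :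
    r / P * Real.log ((r + P) / |r - P|) * (max (2 * τ * k ^ 2) |r ^ 2 - k ^ 2|)⁻¹ ≤
      (k ^ 2)⁻¹ * (logProfile (|r - k| / k) * symbolProfile τ (|r - k| / k) +
        logProfile (|r - P| / k) * symbolProfile τ (|r - P| / k)) := by
  set w := |r - k| / k with hw
  set v := |r - P| / k with hv
  have hw0 : 0 < w := div_pos (abs_pos.2 (sub_ne_zero.2 hrk)) hk
  have hv0 : 0 < v := div_pos (abs_pos.2 (sub_ne_zero.2 hrP)) hk
  have hwk : |r - k| = k * w := by rw [hw]; field_simp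
  have hlw : 0 ≤ Real.log (1 + w) := Real.log_nonneg (by linarith)
  have hA : r / P * Real.log ((r + P) / |r - P|) ≤ logProfile v * (1 + Real.log (1 + w)) := by
    refine (mul_log_add_div_abs_sub_le hr hP hk hrP).trans ?_
    have e1 : k / |r - P| = 1 / v := by rw [hv, one_div_div]
    have e2 : Real.log (1 + 2 * r / k) ≤ 2 + Real.log (1 + w) := by
      have h3 : Real.log 3 ≤ 2 := by
        have := Real.log_le_sub_one_of_pos (x := 3) (by norm_num)
        linarith
      have : Real.log (1 + 2 * r / k) ≤ Real.log (3 * (1 + w)) := by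
        refine Real.log_le_log (by positivity) ?_
        have : r / k ≤ 1 + w := by
          rw [div_le_iff₀ hk, add_mul, one_mul, mul_comm w, ← hwk]
          linarith [le_abs_self (r - k)]
        rw [mul_div_assoc]; linarith
      rw [Real.log_mul (by norm_num) (by positivity)] at this
      linarith
    have h1 : 1 ≤ logProfile v := by
      have : 0 ≤ Real.log (1 + 1 / v) := Real.log_nonneg (by
        have : 0 ≤ 1 / v := by positivity
        linarith)
      unfold logProfile; linarith
    have h2 : logProfile v = 4 + Real.log (1 + k / |r - P|) := by rw [e1]; rfl
    nlinarith
  -- Uses |r²-k²| = kw(r+k) and r+k ≥ k max(1, w).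
  have hB : (max (2 * τ * k ^ 2) |r ^ 2 - k ^ 2|)⁻¹ ≤
      (k ^ 2)⁻¹ * (max (2 * τ) (w * max 1 w))⁻¹ := by
    rw [← mul_inv]
    refine inv_anti₀ (by positivity) ?_
    rw [mul_max_of_nonneg _ _ (by positivity), mul_comm (k ^ 2) (2 * τ)]
    refine max_le_max le_rfl ?_
    have e : |r ^ 2 - k ^ 2| = k * w * (r + k) := by
      rw [show r ^ 2 - k ^ 2 = (r - k) * (r + k) by ring, abs_mul, abs_of_pos (add_pos hr hk), hwk]
    have h2 : k * max 1 w ≤ r + k := by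
      rw [mul_max_of_nonneg _ _ hk.le, ← hwk, mul_one]
      refine max_le (by linarith) ?_
      rw [abs_le]; constructor <;> linarith
    rw [e]
    calc _ = k * w * (k * max 1 w) := by ring
      _ ≤ _ := by gcongr
  have hB0 : 0 ≤ (max (2 * τ * k ^ 2) |r ^ 2 - k ^ 2|)⁻¹ := by positivity
  have hfv := logProfile_nonneg hv0
  calc _ ≤ logProfile v * (1 + Real.log (1 + w)) *
        ((k ^ 2)⁻¹ * (max (2 * τ) (w * max 1 w))⁻¹) :=
        mul_le_mul hA hB hB0 (by positivity)
    _ = (k ^ 2)⁻¹ * (logProfile v * ((1 + Real.log (1 + w)) / max (2 * τ) (w * max 1 w))) := by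
        rw [div_eq_mul_inv]; ring
    _ ≤ (k ^ 2)⁻¹ * (logProfile v * symbolProfile τ w) := by
        gcongr
        exact one_add_log_div_le_symbolProfile hτ hw0
    _ ≤ _ := by
        gcongr
        exact mul_le_add_of_antitoneOn logProfile_antitoneOn (symbolProfile_antitoneOn hτ hτ1)
          (fun _ h ↦ logProfile_nonneg h) (fun _ h ↦ symbolProfile_nonneg hτ h) hv0 hw0

theorem lintegral_log_kernel_le {k τ P : ℝ} (hk : 0 < k) (hτ : 0 < τ) (hτ1 : τ ≤ 1)
    (hP : 0 < P) :
    ∫⁻ r in Set.Ioi (0 : ℝ), ENNReal.ofReal (r / P * Real.log ((r + P) / |r - P|)) *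
      ENNReal.ofReal (max (2 * τ * k ^ 2) |r ^ 2 - k ^ 2|)⁻¹ ≤
      ENNReal.ofReal (2 * (Real.log τ⁻¹ + 11) ^ 2 / k) := by
  set Φ : ℝ → ℝ≥0∞ := fun w ↦ ENNReal.ofReal (logProfile w * symbolProfile τ w) with hΦ
  have hΦm : Measurable Φ := by
    have h1 : Measurable logProfile := by unfold logProfile; fun_prop
    have h2 : Measurable (symbolProfile τ) := by
      unfold symbolProfile
      exact Measurable.ite measurableSet_Iic (by fun_prop) (by fun_prop)
    fun_prop
  have hL0 : 0 ≤ Real.log τ⁻¹ := Real.log_nonneg (one_le_inv_iff₀.2 ⟨hτ, hτ1⟩)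
  calc _ ≤ ∫⁻ r in Set.Ioi (0 : ℝ), ENNReal.ofReal (k ^ 2)⁻¹ *
        (Φ (|r - k| / k) + Φ (|r - P| / k)) := by
        refine lintegral_mono_ae ?_
        have hne : ∀ a : ℝ, ∀ᵐ r ∂((volume : Measure ℝ).restrict (Set.Ioi 0)), r ≠ a :=
          fun a ↦ ae_restrict_of_ae (by simp [ae_iff])
        filter_upwards [hne k, hne P, ae_restrict_mem measurableSet_Ioi] with r hrk hrP hr
        have hw0 : 0 < |r - k| / k := div_pos (abs_pos.2 (sub_ne_zero.2 hrk)) hk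
        have hv0 : 0 < |r - P| / k := div_pos (abs_pos.2 (sub_ne_zero.2 hrP)) hk
        have hw1 := mul_nonneg (logProfile_nonneg hw0) (symbolProfile_nonneg hτ hw0)
        have hv1 := mul_nonneg (logProfile_nonneg hv0) (symbolProfile_nonneg hτ hv0)
        rw [← ENNReal.ofReal_mul' (by positivity)]
        simp only [hΦ]
        rw [← ENNReal.ofReal_add hw1 hv1, ← ENNReal.ofReal_mul (by positivity)]
        exact ENNReal.ofReal_le_ofReal (log_kernel_mul_inv_le hk hτ hτ1 hP hr hrk hrP)
    _ ≤ ∫⁻ r : ℝ, ENNReal.ofReal (k ^ 2)⁻¹ * (Φ (|r - k| / k) + Φ (|r - P| / k)) :=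
        setLIntegral_le_lintegral _ _
    -- The 4 counts two centres, k and P, and the two sides of each.
    _ = ENNReal.ofReal (4 / k) * ∫⁻ w in Set.Ioi (0 : ℝ), Φ w := by
        rw [lintegral_const_mul' _ _ ENNReal.ofReal_ne_top, lintegral_add_left (by fun_prop),
          lintegral_comp_abs_sub_div Φ k hk, lintegral_comp_abs_sub_div Φ P hk, ← two_mul,
          ← mul_assoc, ← mul_assoc, ← mul_assoc]
        congr 1
        rw [← ENNReal.ofReal_ofNat, ← ENNReal.ofReal_mul (by positivity),
          ← ENNReal.ofReal_mul (by positivity), ← ENNReal.ofReal_mul (by positivity)]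
        congr 1
        field_simp; norm_num
    _ ≤ ENNReal.ofReal (4 / k) *
          ENNReal.ofReal (Real.log τ⁻¹ ^ 2 / 2 + 8 * Real.log τ⁻¹ + 60) := by
        gcongr
        exact lintegral_profile_le hτ hτ1
    _ ≤ _ := by
        rw [← ENNReal.ofReal_mul (by positivity)]
        refine ENNReal.ofReal_le_ofReal ?_
        rw [div_mul_eq_mul_div]
        -- With L = log τ⁻¹ the claim is 2L² + 32L + 240 ≤ 2(L+11)² = 2L² + 44L + 242, which is
        -- where 11 comes from.
        exact div_le_div_of_nonneg_right (by nlinarith) hk.le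

/-! ### From the Schur bound to the BCS operator. -/

/-- Lower bound for the symbol `K_{T,μ}(2πξ)`, with `T = τ μ`. -/
noncomputable def symbolMinorant (τ μ : ℝ) (ξ : R3) : ℝ := max (2 * τ * μ) |‖(2 * Real.pi) • ξ‖ ^ 2 - μ|

theorem lintegral_inv_symbolMinorant_le {τ μ : ℝ} (hμ : 0 < μ) (hτ : 0 < τ) (hτ1 : τ ≤ 1)
    {ξ : R3} (hξ : ξ ≠ 0) :
    ∫⁻ η : R3, ENNReal.ofReal (Real.pi * ‖ξ - η‖ ^ 2)⁻¹ *
      ENNReal.ofReal (symbolMinorant τ μ η)⁻¹ ≤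
      ENNReal.ofReal (2 * (Real.log τ⁻¹ + 11) ^ 2 / (Real.pi * Real.sqrt μ)) := by
  have hπ := Real.pi_pos
  -- The Fermi radius in the variable ξ, since the momentum is 2πξ.
  set k := Real.sqrt μ / (2 * Real.pi) with hk
  have hk0 : 0 < k := by positivity
  have hk2 : k ^ 2 = μ / (4 * Real.pi ^ 2) := by
    rw [hk, div_pow, Real.sq_sqrt hμ.le]; ring
  set f : ℝ → ℝ≥0∞ := fun r ↦ ENNReal.ofReal (max (2 * τ * k ^ 2) |r ^ 2 - k ^ 2|)⁻¹ with hf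
  have hm : ∀ η, symbolMinorant τ μ η =
      (4 * Real.pi ^ 2) * max (2 * τ * k ^ 2) |‖η‖ ^ 2 - k ^ 2| := by
    intro η
    rw [mul_max_of_nonneg _ _ (by positivity), symbolMinorant, hk2, norm_smul,
      Real.norm_of_nonneg (by positivity)]
    congr 1
    · field_simp
    · rw [← abs_of_pos (show 0 < 4 * Real.pi ^ 2 by positivity), ← abs_mul, abs_of_pos
        (show 0 < 4 * Real.pi ^ 2 by positivity)]
      congr 1
      field_simp; ring
  calc _ = ∫⁻ η : R3, ENNReal.ofReal (4 * Real.pi ^ 3)⁻¹ *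
        (ENNReal.ofReal (‖ξ - η‖ ^ 2)⁻¹ * f ‖η‖) := by
        refine lintegral_congr fun η ↦ ?_
        rw [hm, ← ENNReal.ofReal_mul (by positivity), hf, ← ENNReal.ofReal_mul (by positivity),
          ← ENNReal.ofReal_mul (by positivity)]
        congr 1
        simp only [mul_inv]
        ring
    _ = ENNReal.ofReal (4 * Real.pi ^ 3)⁻¹ * (ENNReal.ofReal (2 * Real.pi) *
        ∫⁻ r in Set.Ioi (0 : ℝ),
          ENNReal.ofReal (r / ‖ξ‖ * Real.log ((r + ‖ξ‖) / |r - ‖ξ‖|)) * f r) := by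
        rw [lintegral_const_mul' _ _ ENNReal.ofReal_ne_top,
          lintegral_radial_mul_inv_sq_dist (by fun_prop) hξ]
    _ ≤ ENNReal.ofReal (4 * Real.pi ^ 3)⁻¹ * (ENNReal.ofReal (2 * Real.pi) *
        ENNReal.ofReal (2 * (Real.log τ⁻¹ + 11) ^ 2 / k)) := by
        gcongr
        exact lintegral_log_kernel_le hk0 hτ hτ1 (norm_pos_iff.2 hξ)
    _ = _ := by
        rw [← ENNReal.ofReal_mul (by positivity), ← ENNReal.ofReal_mul (by positivity)]
        congr 1
        have : 0 < Real.sqrt μ := by positivity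
        rw [hk]
        field_simp
        norm_num

theorem sinh_le_mul_cosh {x : ℝ} (hx : 0 ≤ x) : Real.sinh x ≤ x * Real.cosh x := by
  have hd : ∀ y : ℝ, HasDerivAt (fun y ↦ y * Real.cosh y - Real.sinh y) (y * Real.sinh y) y := by
    intro y
    convert! ((hasDerivAt_id y).mul (Real.hasDerivAt_cosh y)).sub (Real.hasDerivAt_sinh y) using 1
    simp
  have hmono : MonotoneOn (fun y ↦ y * Real.cosh y - Real.sinh y) (Set.Ici 0) := by
    refine monotoneOn_of_deriv_nonneg (convex_Ici 0)
      (fun y _ ↦ (hd y).continuousAt.continuousWithinAt)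
      (fun y _ ↦ (hd y).differentiableAt.differentiableWithinAt) fun y hy ↦ ?_
    rw [interior_Ici] at hy
    rw [(hd y).deriv]
    exact mul_nonneg (le_of_lt hy) (Real.sinh_nonneg_iff.2 (le_of_lt hy))
  have := hmono (Set.mem_Ici.2 le_rfl) (Set.mem_Ici.2 hx) hx
  simp at this
  linarith

theorem max_le_bcsSymbol {T μ : ℝ} (hT : 0 < T) (p : R3) :
    max (2 * T) |‖p‖ ^ 2 - μ| ≤ bcsSymbol T μ p := by
  unfold bcsSymbol
  split_ifs with h
  · simp [h, hT.le]
  · set x := |‖p‖ ^ 2 - μ| with hx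
    have hx0 : 0 < x := abs_pos.2 (sub_ne_zero.2 h)
    have hy : 0 < x / (2 * T) := by positivity
    have hc := Real.cosh_pos (x / (2 * T))
    have hs : 0 < Real.sinh (x / (2 * T)) := Real.sinh_pos_iff.2 hy
    rw [Real.tanh_eq_sinh_div_cosh, div_div_eq_mul_div]
    refine max_le ?_ ?_
    · rw [le_div_iff₀ hs]
      calc 2 * T * Real.sinh (x / (2 * T)) ≤ 2 * T * (x / (2 * T) * Real.cosh (x / (2 * T))) := by
            gcongr
            exact sinh_le_mul_cosh hy.le
        _ = _ := by field_simp
    · rw [le_div_iff₀ hs]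
      gcongr
      exact (Real.sinh_lt_cosh _).le

/-- The chemical potential μ' of the minorant may differ from μ, so that small μ can be compared
with one fixed larger value. -/
theorem bcsNonneg_of_symbolMinorant_le {V : R3 → ℝ}
    (hV : MemLp (fun x : R3 ↦ ‖x‖ * V x) ∞ volume) {T μ τ μ' : ℝ}
    (hW : 0 < weightedSupNorm V) (hμ' : 0 < μ') (hτ : 0 < τ) (hτ1 : τ ≤ 1)
    (hle : ∀ ξ, symbolMinorant τ μ' ξ ≤ bcsSymbol T μ ((2 * Real.pi) • ξ))
    (hτW : 2 * (Real.log τ⁻¹ + 11) ^ 2 / (Real.pi * Real.sqrt μ') ≤ (weightedSupNorm V)⁻¹) :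
    BCSNonneg T μ V := by
  intro ψ hψ
  set W := weightedSupNorm V with hWdef
  have hpos : ∀ ξ, 0 < symbolMinorant τ μ' ξ := fun ξ ↦
    lt_max_of_lt_left (by positivity)
  have hmeas : Measurable (symbolMinorant τ μ') := by
    unfold symbolMinorant; fun_prop
  have hne : ∀ᵐ x : R3, x ≠ 0 := by simp [ae_iff]
  have hmain := lintegral_inv_norm_mul_sq_le hmeas hpos (c := ENNReal.ofReal W⁻¹)
    (hne.mono fun ξ hξ ↦ (lintegral_inv_symbolMinorant_le hμ' hτ hτ1 hξ).trans
      (ENNReal.ofReal_le_ofReal hτW)) ψ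
  have hVle : ∀ᵐ x : R3, |V x| ≤ W * ‖x‖⁻¹ := by
    filter_upwards [ae_le_lpNorm_exponent_top hV, hne] with x hx hx0
    have : 0 < ‖x‖ := norm_pos_iff.2 hx0
    rw [norm_mul, norm_norm, Real.norm_eq_abs] at hx
    rw [← div_eq_mul_inv, le_div_iff₀ this, mul_comm]
    exact hx
  have hVm : AEStronglyMeasurable V volume := by
    have h1 : AEStronglyMeasurable (fun x : R3 ↦ ‖x‖⁻¹ * (‖x‖ * V x)) volume :=
      (by fun_prop : Measurable fun x : R3 ↦ ‖x‖⁻¹).aestronglyMeasurable.mul hV.1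
    refine h1.congr (hne.mono fun x hx ↦ ?_)
    have : ‖x‖ ≠ 0 := norm_ne_zero_iff.2 hx
    simp only
    field_simp
  have hkin0 : ∀ ξ, 0 ≤ kineticDensity T μ ψ ξ := fun ξ ↦
    mul_nonneg ((hpos ξ).le.trans (hle ξ)) (by positivity)
  have hbound : ∫⁻ x, ‖potentialDensity V ψ x‖ₑ ≤ ENNReal.ofReal (∫ ξ, kineticDensity T μ ψ ξ) := by
    calc ∫⁻ x, ‖potentialDensity V ψ x‖ₑ
        ≤ ∫⁻ x, ENNReal.ofReal W * (ENNReal.ofReal ‖x‖⁻¹ * ‖ψ x‖ₑ ^ 2) := by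
          refine lintegral_mono_ae (hVle.mono fun x hx ↦ ?_)
          rw [potentialDensity, enorm_mul, enorm_pow, enorm_norm, ← mul_assoc,
            ← ENNReal.ofReal_mul hW.le, ← ofReal_norm, Real.norm_eq_abs]
          gcongr
      _ = ENNReal.ofReal W * ∫⁻ x, ENNReal.ofReal ‖x‖⁻¹ * ‖ψ x‖ₑ ^ 2 :=
          lintegral_const_mul' _ _ ENNReal.ofReal_ne_top
      _ ≤ ENNReal.ofReal W * (ENNReal.ofReal W⁻¹ * ∫⁻ ξ, ENNReal.ofReal (symbolMinorant τ μ' ξ) *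
            ‖(𝓕 ψ : Lp ℂ 2 (volume : Measure R3)) ξ‖ₑ ^ 2) := by gcongr
      _ = ∫⁻ ξ, ENNReal.ofReal (symbolMinorant τ μ' ξ) *
            ‖(𝓕 ψ : Lp ℂ 2 (volume : Measure R3)) ξ‖ₑ ^ 2 := by
          rw [← mul_assoc, ← ENNReal.ofReal_mul hW.le, mul_inv_cancel₀ hW.ne',
            ENNReal.ofReal_one, one_mul]
      _ ≤ ∫⁻ ξ, ENNReal.ofReal (kineticDensity T μ ψ ξ) := by
          refine lintegral_mono fun ξ ↦ ?_
          rw [kineticDensity, ENNReal.ofReal_mul ((hpos ξ).le.trans (hle ξ)),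
            ENNReal.ofReal_pow (norm_nonneg _), ofReal_norm]
          gcongr
          exact hle ξ
      _ = _ := (ofReal_integral_eq_lintegral_ofReal hψ (Filter.Eventually.of_forall hkin0)).symm
  have hint : Integrable (potentialDensity V ψ) :=
    ⟨hVm.mul ((Lp.aestronglyMeasurable ψ).norm.pow 2), hbound.trans_lt ENNReal.ofReal_lt_top⟩
  refine ⟨hint, ?_⟩
  have h1 : ‖∫ x, potentialDensity V ψ x‖ ≤ ∫ ξ, kineticDensity T μ ψ ξ := by
    rw [← ENNReal.ofReal_le_ofReal_iff (integral_nonneg hkin0), ofReal_norm]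
    exact (enorm_integral_le_lintegral_enorm _).trans hbound
  have h2 := neg_le_of_abs_le h1
  linarith

theorem mainTheorem4 (V : R3 → ℝ)
    (hV : MemLp (fun x : R3 => ‖x‖ * V x) ∞ volume)
    (hV0 : ¬ V =ᵐ[volume] 0)
    (μ₀ : ℝ) (hμ₀ : 0 < μ₀) :
    ∃ C₁ : ℝ, 0 < C₁ ∧ ∀ μ : ℝ, μ₀ ≤ μ →
      (normalTemperatures μ V).Nonempty ∧
      criticalTemperature μ V ≤
        C₁ * μ * Real.exp (-(Real.sqrt (Real.pi / (2 * weightedSupNorm V)) * μ ^ (1 / 4 : ℝ))) := by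
  have hW : 0 < weightedSupNorm V := by
    refine lt_of_le_of_ne lpNorm_nonneg fun h ↦ hV0 ?_
    have h0 := (lpNorm_eq_zero hV (by simp)).1 h.symm
    have hne : ∀ᵐ x : R3, x ≠ 0 := by simp [ae_iff]
    filter_upwards [h0, hne] with x hx hx0
    simpa [hx0] using hx
  set W := weightedSupNorm V with hWdef
  set C := Real.sqrt (Real.pi / (2 * W)) with hC
  have hC0 : 0 < C := Real.sqrt_pos.2 (by positivity)
  set ℓ : ℝ → ℝ := fun μ ↦ C * μ ^ (1 / 4 : ℝ) with hℓ
  have hℓmono : ∀ a b, 0 < a → a ≤ b → ℓ a ≤ ℓ b := fun a b ha hab ↦ by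
    simp only [hℓ]; gcongr
  -- This identity dictates the value of C: the Schur constant is exactly 1/W when log τ⁻¹ + 11 = ℓ
  -- μ.
  have hcrit : ∀ μ, 0 < μ → 2 * ℓ μ ^ 2 / (Real.pi * Real.sqrt μ) = W⁻¹ := by
    intro μ hμ
    have e1 : (μ ^ (1 / 4 : ℝ)) ^ 2 = Real.sqrt μ := by
      rw [← Real.rpow_natCast, ← Real.rpow_mul hμ.le, Real.sqrt_eq_rpow]; norm_num
    have : 0 < Real.sqrt μ := Real.sqrt_pos.2 hμ
    simp only [hℓ]
    rw [mul_pow, e1, hC, Real.sq_sqrt (by positivity)]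
    field_simp
  have hnonneg : ∀ T μ μ', 0 < T → 0 < μ' → 11 ≤ ℓ μ' →
      (∀ s : ℝ, 0 ≤ s → max (2 * Real.exp (11 - ℓ μ') * μ') |s - μ'| ≤ max (2 * T) |s - μ|) →
      T ∈ normalTemperatures μ V := by
    intro T μ μ' hT hμ' hℓμ' hmax
    refine ⟨hT, bcsNonneg_of_symbolMinorant_le hV hW hμ' (Real.exp_pos (11 - ℓ μ'))
      (Real.exp_le_one_iff.2 (by linarith)) (fun ξ ↦ ?_) ?_⟩
    · exact (hmax _ (by positivity)).trans (max_le_bcsSymbol hT _)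
    · rw [Real.log_inv, Real.log_exp, ← hcrit μ' hμ']
      apply le_of_eq
      ring_nf
  -- From this threshold on ℓ μ ≥ 11, so that τ = exp(11 - ℓ μ) ≤ 1.
  set μ₁ := max μ₀ ((11 / C) ^ 4) with hμ₁
  have hμ₁0 : 0 < μ₁ := lt_max_of_lt_left hμ₀
  have hℓ11 : ∀ μ, μ₁ ≤ μ → 11 ≤ ℓ μ := by
    intro μ hμ
    have h1 : (11 / C) ^ 4 ≤ μ := (le_max_right _ _).trans hμ
    have h2 : 11 / C ≤ μ ^ (1 / 4 : ℝ) := by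
      calc 11 / C = ((11 / C) ^ 4) ^ (1 / 4 : ℝ) := by
            rw [← Real.rpow_natCast, ← Real.rpow_mul (by positivity)]; norm_num
        _ ≤ _ := by gcongr
    rwa [div_le_iff₀' hC0] at h2
  -- The first entry serves μ ≥ μ₁; the second forces the temperature to be at least μ₁ for μ₀ ≤ μ ≤
  -- μ₁.
  set C₁ := max (Real.exp 11) (μ₁ / μ₀ * Real.exp (ℓ μ₁)) with hC₁
  have hC₁0 : 0 < C₁ := lt_max_of_lt_left (Real.exp_pos _)
  refine ⟨C₁, hC₁0, fun μ hμ ↦ ?_⟩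
  have hμ0 : 0 < μ := hμ₀.trans_le hμ
  have hT : C₁ * μ * Real.exp (-ℓ μ) ∈ normalTemperatures μ V := by
    have hT0 : 0 < C₁ * μ * Real.exp (-ℓ μ) := by positivity
    rcases le_total μ₁ μ with h | h
    · refine hnonneg _ μ μ hT0 hμ0 (hℓ11 μ h) fun s _ ↦ max_le_max ?_ le_rfl
      have : Real.exp 11 ≤ C₁ := le_max_left _ _
      rw [sub_eq_add_neg, Real.exp_add]
      calc _ = 2 * (Real.exp 11 * μ * Real.exp (-ℓ μ)) := by ring
        _ ≤ _ := by gcongr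
    · have hTμ : μ₁ ≤ C₁ * μ * Real.exp (-ℓ μ) := by
        calc μ₁ = μ₁ / μ₀ * Real.exp (ℓ μ₁) * μ₀ * Real.exp (-ℓ μ₁) := by
              rw [Real.exp_neg]; field_simp
          _ ≤ C₁ * μ * Real.exp (-ℓ μ) := by
              gcongr
              · exact le_max_right _ _
              · exact hℓmono μ μ₁ hμ0 h
      refine hnonneg _ μ μ₁ hT0 hμ₁0 (hℓ11 μ₁ le_rfl) fun s hs ↦ max_le ?_ ?_
      · refine le_max_of_le_left ?_
        have : Real.exp (11 - ℓ μ₁) ≤ 1 := Real.exp_le_one_iff.2 (by linarith [hℓ11 μ₁ le_rfl])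
        nlinarith
      -- Below μ₁ the distance |s - μ₁| is at most μ₁ ≤ T; above it, s ≥ μ₁ ≥ μ makes it at most |s
      -- - μ|.
      · rcases le_total s μ₁ with h' | h'
        · refine le_max_of_le_left ?_
          rw [abs_of_nonpos (by linarith)]; linarith
        · refine le_max_of_le_right ?_
          rw [abs_of_nonneg (by linarith), abs_of_nonneg (by linarith)]; linarith
  exact ⟨⟨_, hT⟩, csInf_le ⟨0, fun _ h ↦ h.1.le⟩ hT⟩
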